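/- Let $N\ge 2$ be an integer, $n=N-1$, and let $\mathfrak s_\kappa$ be the solution of $f''+\kappa f=0$, $f(0)=0$, $f'(0)=1$, $T_\kappa\in(0,\infty]$ its first positive zero, and $\mathfrak D_{K,N}(t)=\mathfrak s_{K/n}(t)^{-n}\int_0^t\mathfrak s_{K/n}(s)^{n}\,ds$ for $0<t<T_{K/n}$ (so $\mathfrak D_{0,N}(t)=t/N$). Let $X$ be a region of a time-oriented Lorentzian manifold of signature $(-,+,\dots,+)$, with its volume measure $\mathfrak m$. Let $\le$ be the causal relation of $X$ ($x\le y$ if $x=y$ or some future-directed Lipschitz causal curve inside $X$ goes from $x$ to $y$), and let $\tau(x,y)$ be the supremum of the Lorentzian lengths of the future-directed Lipschitz timelike curves inside $X$ from $x$ to $y$ ($0$ if there is none); $x\ll y$ means $\tau(x,y)>0$. For an achronal set $V$ let $\tau_V(x)=\sup_{y\in V}\tau(y,x)$ on $I^+(V)$, $\tau_V(x)=-\sup_{y\in V}\tau(x,y)$ on $I^-(V)$, $\tau_V=0$ elsewhere; for $S\subset I^+(V)$ put $\mathrm{dist}(V,S)=\inf_S\tau_V$, and let $C(V,S)$ be the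 union of the geodesics (continuous $\gamma:[0,1]\to X$ with $\tau(\gamma_s,\gamma_t)=(t-s)\,\tau(\gamma_0,\gamma_1)$ for $s<t$) from $\gamma_0\in V$ to $\gamma_1\in S$ of $\tau$-length $\tau_V(\gamma_1)$. Let $$\mathfrak m^+(S)=\inf_{U\supset S\text{ open}}\ \limsup_{\varepsilon\downarrow0}\frac{\mathfrak m(\tau_S^{-1}((0,\varepsilon))\cap U)}{\varepsilon}$$ be the future Minkowski content. The isoperimetric-type inequality $$\mathfrak m^+(S)\,\mathfrak D_{K,N}(\mathrm{dist}(V,S))\le\mathfrak m(C(V,S)),\qquad\text{for }K=0:\quad \mathfrak m^+(S)\,\mathrm{dist}(V,S)\le N\,\mathfrak m(C(V,S)),$$ concerns Borel, achronal, timelike complete sets $V$ and compact acausal sets $S\subset I^+(V)$ with $S\subset I^-(B)$ for some $B\subset X$. It is sharp, in the following sense. Let $a>0$ and $H_a=\{(x,t)\in\mathbb R^{n}\times\mathbb R: t^2-\|x\|^2=1,\ t>0,\ \|x\|\le a\}$. * $K=0$. In the $N$-dimensional Minkowski space $\mathbb R^n\times\mathbb R$ with metric $dx^2-dt^2$, let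 $X$ be the cone $\{t\ge\|x\|\sqrt{1+a^2}/a\}$, $V=\{0\}$, and, for $\rho>0$, $S=\{(x,t)\in X:t^2-\|x\|^2=\rho^2\}=\rho H_a$. * $K>0$. Let $\kappa=K/(N-1)$ and let $M$ be the $N$-dimensional anti-de Sitter space $\{\|x\|^2-t^2-w^2=-1/\kappa\}\subset\mathbb R^{n}\times\mathbb R\times\mathbb R$ with the metric induced by $dx^2-dt^2-dw^2$ and the time orientation given by $w\,\partial_t-t\,\partial_w$ (constant sectional curvature $-K/(N-1)$; $\mathrm{Ric}(v,v)=K$ for unit timelike $v$). * $K<0$. Let $\kappa=K/(N-1)$ and let $M$ be the $N$-dimensional de Sitter space $\{\|x\|^2-t^2+w^2=1/|\kappa|\}$ with the metric induced by $dx^2-dt^2+dw^2$ and the time orientation in which $t$ increases (constant sectional curvature $-K/(N-1)$; $\mathrm{Ric}(v,v)=K$ for unit timelike $v$). For $K\ne0$ let $p=(0,0,|\kappa|^{-1/2})\in M$, regard $H_a$ as a set of unit timelike vectors tangent to $M$ at $p$ (with zero $w$-component), let $X=\{\exp_p(ru):0\le r<T_\kappa,\ u\in H_a\}$, $V=\{p\}$,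 and, for $0<\rho<T_\kappa$, $S=\exp_p(\rho H_a)$. On $X\setminus\{p\}$, at points $\exp_p(ru)$, the metric is $-dr^2+\mathfrak s_\kappa(r)^2 g_{\mathbb H^{n}}$. In each of the three cases, for all such $a$ and $\rho$, the sets $V$, $S$ are as required above, $\mathrm{dist}(V,S)=\rho$, $\mathfrak m^+(S)$ equals the Riemannian area $\mathrm{Area}(S)$ of $S$ for the induced metric, $0<\mathfrak m(C(V,S))<\infty$, and equality holds: $$\mathfrak m^+(S)\,\mathfrak D_{K,N}(\mathrm{dist}(V,S))=\mathfrak m(C(V,S));$$ for $K=0$ this reads $\mathrm{Area}(S)\,\mathrm{dist}(V,S)=N\,\mathfrak m(C(V,S))$. -/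

import Mathlib

open Set Filter Topology MeasureTheory

noncomputable section

namespace LorentzIsop

/-! ### Measured Lorentzian spaces: causal relation, time separation, reference measure -/

/-- The data of a measured Lorentzian space on a topological space `X`: causal relation `≤`,
time separation `τ` with values in `[0, ∞]`, and reference measure. -/
structure Space (X : Type*) [MeasurableSpace X] where
  le : X → X → Prop
  τ : X → X → ENNReal
  vol : Measure X

namespace Space

variable {X : Type*} [TopologicalSpace X] [MeasurableSpace X] (L : Space X)

/-- Chronological relation `x ≪ y`. -/
def chron (x y : X) : Prop := 0 < L.τ x y

/-- Chronological future `I⁺(A)`. -/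
def chronFuture (A : Set X) : Set X := {y | ∃ x ∈ A, L.chron x y}

/-- Chronological past `I⁻(A)`. -/
def chronPast (A : Set X) : Set X := {x | ∃ y ∈ A, L.chron x y}

def Achronal (A : Set X) : Prop := ∀ x ∈ A, ∀ y ∈ A, ¬ L.chron x y

/-- No two distinct points of `A` are causally related. -/
def Acausal (A : Set X) : Prop := ∀ x ∈ A, ∀ y ∈ A, L.le x y → x = y

/-- `V` is future and past timelike complete: `J⁻(x) ∩ V` for `x ∈ I⁺(V)` and `J⁺(x) ∩ V` for
`x ∈ I⁻(V)` have compact closure, contained in `V`. -/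
def TimelikeComplete (V : Set X) : Prop :=
  (∀ x ∈ L.chronFuture V, IsCompact (closure ({y | L.le y x} ∩ V)) ∧
    closure ({y | L.le y x} ∩ V) ⊆ V) ∧
  (∀ x ∈ L.chronPast V, IsCompact (closure ({y | L.le x y} ∩ V)) ∧
    closure ({y | L.le x y} ∩ V) ⊆ V)

open Classical in
/-- Signed time separation `τ_V` from an achronal set `V`. -/
def tauFrom (V : Set X) (x : X) : EReal :=
  if x ∈ L.chronFuture V then ((⨆ y ∈ V, L.τ y x : ENNReal) : EReal)
  else if x ∈ L.chronPast V then -((⨆ y ∈ V, L.τ x y : ENNReal) : EReal)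
  else 0

/-- `dist(V, S) = inf_S τ_V`. -/
def dist (V S : Set X) : EReal := ⨅ x ∈ S, L.tauFrom V x

/-- The `τ`-length of a curve: infimum of `∑ τ(γ(tᵢ), γ(tᵢ₊₁))` over all partitions
`0 = t₀ < t₁ < ⋯ < t_k = 1`. -/
def length (γ : C(unitInterval, X)) : ENNReal :=
  ⨅ (k : ℕ) (t : Fin (k + 1) → unitInterval)
    (_ : StrictMono t ∧ t 0 = 0 ∧ t (Fin.last k) = 1),
    ∑ i : Fin k, L.τ (γ (t i.castSucc)) (γ (t i.succ))

/-- Causal geodesics, parametrized proportionally to `τ`-arclength. -/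
def Geo : Set C(unitInterval, X) :=
  {γ | ∀ s t : unitInterval, s < t →
    L.τ (γ s) (γ t) = ENNReal.ofReal ((t : ℝ) - (s : ℝ)) * L.τ (γ 0) (γ 1)}

/-- The conical region `C(V, S)` spanned by the `τ_V`-maximizing geodesics from `V` to `S`. -/
def cone (V S : Set X) : Set X :=
  {x | ∃ γ ∈ L.Geo, ∃ t : unitInterval, γ 0 ∈ V ∧ γ 1 ∈ S ∧
    ((L.length γ : ENNReal) : EReal) = L.tauFrom V (γ 1) ∧ x = γ t}

/-- Future timelike Minkowski content `𝔪⁺(A)`. -/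
def minkowskiContent (A : Set X) : ENNReal :=
  ⨅ (U : Set X) (_ : IsOpen U ∧ A ⊆ U),
    limsup (fun ε : ℝ =>
      L.vol (L.tauFrom A ⁻¹' Ioo (0 : EReal) (ε : EReal) ∩ U) / ENNReal.ofReal ε) (𝓝[>] 0)

/-- The requirements on the pair `(V, S)` in the isoperimetric-type inequality. -/
structure Admissible (V S : Set X) : Prop where
  borel : MeasurableSet V
  achronal : L.Achronal V
  timelikeComplete : L.TimelikeComplete V
  compact : IsCompact S
  acausal : L.Acausal S
  future : S ⊆ L.chronFuture V
  past : ∃ B : Set X, S ⊆ L.chronPast B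

end Space

/-! ### Regions in submanifolds of a pseudo-Euclidean space -/

section Region

variable {W : Type*} [NormedAddCommGroup W] [NormedSpace ℝ W]

/-- Lipschitz curves `[0,1] → X` with future-directed timelike velocity almost everywhere. Here `B`
is the ambient bilinear form and the timelike vector field `T` gives the time orientation: a causal
vector `v` at `q` is future directed if `B (T q) v < 0`. -/
def IsTimelikeCurve (B : W → W → ℝ) (T : W → W) (X : Set W) (γ : ℝ → W) : Prop :=
  (∃ C, LipschitzOnWith C γ (Icc 0 1)) ∧ (∀ s ∈ Icc (0 : ℝ) 1, γ s ∈ X) ∧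
    ∀ᵐ s ∂(volume.restrict (Icc (0 : ℝ) 1)),
      B (deriv γ s) (deriv γ s) < 0 ∧ B (T (γ s)) (deriv γ s) < 0

/-- Lipschitz curves `[0,1] → X` with future-directed causal velocity almost everywhere. -/
def IsCausalCurve (B : W → W → ℝ) (T : W → W) (X : Set W) (γ : ℝ → W) : Prop :=
  (∃ C, LipschitzOnWith C γ (Icc 0 1)) ∧ (∀ s ∈ Icc (0 : ℝ) 1, γ s ∈ X) ∧
    ∀ᵐ s ∂(volume.restrict (Icc (0 : ℝ) 1)),
      B (deriv γ s) (deriv γ s) ≤ 0 ∧ B (T (γ s)) (deriv γ s) < 0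

/-- Lorentzian length `∫₀¹ √(-B(γ', γ'))`. -/
def properTime (B : W → W → ℝ) (γ : ℝ → W) : ENNReal :=
  ∫⁻ s in Icc (0 : ℝ) 1, ENNReal.ofReal (Real.sqrt (-B (deriv γ s) (deriv γ s)))

/-- The region `X`, with the metric induced by `B`, as a measured Lorentzian space: causal relation
and time separation come from the causal and timelike curves inside `X`, and the measure is the
restriction of `μ`. -/
def regionSpace [MeasurableSpace W] (B : W → W → ℝ) (T : W → W) (μ : Measure W) (X : Set W) :
    Space X where
  le x y := x = y ∨ ∃ γ : ℝ → W, IsCausalCurve B T X γ ∧ γ 0 = x ∧ γ 1 = y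
  τ x y := ⨆ (γ : ℝ → W) (_ : IsTimelikeCurve B T X γ ∧ γ 0 = x ∧ γ 1 = y), properTime B γ
  vol := μ.comap Subtype.val

/-- `√|det (B(∂ᵢΦ, ∂ⱼΦ))|`, with the derivatives of `Φ` in the directions of the basis `b`. -/
def gramDensity {ι P : Type*} [Fintype ι] [DecidableEq ι] [NormedAddCommGroup P]
    [NormedSpace ℝ P] (B : W → W → ℝ) (b : ι → P) (Φ : P → W) (z : P) : ℝ :=
  Real.sqrt |(Matrix.of fun i j => B (fderiv ℝ Φ z (b i)) (fderiv ℝ Φ z (b j))).det|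

/-- The volume measure, for the metric induced by `B`, of the submanifold of `W` parametrized by the
injective map `Φ` on `D`; here `b` is a basis of the parameter space whose unit cube has volume one.
-/
def paramVolume {ι P : Type*} [Fintype ι] [DecidableEq ι] [NormedAddCommGroup P]
    [NormedSpace ℝ P] [MeasureSpace P] [MeasurableSpace W]
    (B : W → W → ℝ) (b : ι → P) (Φ : P → W) (D : Set P) : Measure W :=
  ((volume.restrict D).withDensity fun z => ENNReal.ofReal (gramDensity B b Φ z)).map Φ

end Region

/-! ### The comparison functions -/

/-- `𝔰_κ`: the solution of `f'' + κ f = 0`, `f 0 = 0`, `f' 0 = 1`. -/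
def sn (κ r : ℝ) : ℝ :=
  if 0 < κ then Real.sin (Real.sqrt κ * r) / Real.sqrt κ
  else if κ < 0 then Real.sinh (Real.sqrt (-κ) * r) / Real.sqrt (-κ)
  else r

/-- `𝔠_κ`: the derivative of `𝔰_κ`. -/
def cs (κ r : ℝ) : ℝ :=
  if 0 < κ then Real.cos (Real.sqrt κ * r)
  else if κ < 0 then Real.cosh (Real.sqrt (-κ) * r)
  else 1

/-- `𝔇_{K,N}(t) = 𝔰_{K/(N-1)}(t)^{-(N-1)} ∫₀ᵗ 𝔰_{K/(N-1)}(s)^{N-1} ds`. -/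
def DKN (K : ℝ) (N : ℕ) (t : ℝ) : ℝ :=
  1 / sn (K / ((N : ℝ) - 1)) t ^ (N - 1) * ∫ s in (0 : ℝ)..t, sn (K / ((N : ℝ) - 1)) s ^ (N - 1)

/-! ### Minkowski space -/

/-- `ℝⁿ` with its Euclidean structure. -/
abbrev Euc (n : ℕ) := EuclideanSpace ℝ (Fin n)

/-- Points `(x, t)` of the `(n+1)`-dimensional Minkowski space. -/
abbrev Mink (n : ℕ) := Euc n × ℝ

/-- `x · x' - t t'`. -/
def minkForm (n : ℕ) (u v : Mink n) : ℝ := inner ℝ u.1 v.1 - u.2 * v.2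

/-- Time orientation of Minkowski space: the vector field `∂_t`. -/
def minkTime (n : ℕ) : Mink n → Mink n := fun _ => (0, 1)

/-- The standard basis of `ℝⁿ`. -/
def eucBasis (n : ℕ) : Fin n → Euc n := fun i => EuclideanSpace.single i 1

/-- The future unit hyperboloid as a graph over `ℝⁿ`. -/
def hyp (n : ℕ) (x : Euc n) : Mink n := (x, Real.sqrt (1 + ‖x‖ ^ 2))

/-- The part `‖x‖ ≤ a` of the future unit hyperboloid. -/
def hypCap (n : ℕ) (a : ℝ) : Set (Mink n) :=
  {u | u.2 ^ 2 - ‖u.1‖ ^ 2 = 1 ∧ 0 < u.2 ∧ ‖u.1‖ ≤ a}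

/-- The solid cone `t ≥ ‖x‖ √(1 + a²) / a`. -/
def minkCone (n : ℕ) (a : ℝ) : Set (Mink n) :=
  {y | ‖y.1‖ * Real.sqrt (1 + a ^ 2) / a ≤ y.2}

/-- The solid cone in Minkowski space as a measured Lorentzian space, with Lebesgue measure. -/
def minkSpace (n : ℕ) (a : ℝ) : Space (minkCone n a) :=
  regionSpace (minkForm n) (minkTime n) volume (minkCone n a)

/-- The origin. -/
def minkTip (n : ℕ) (a : ℝ) : Set (minkCone n a) := {q | (q : Mink n) = 0}

/-- The part in the cone of the hyperboloid `t² - ‖x‖² = ρ²`. -/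
def minkSlice (n : ℕ) (a ρ : ℝ) : Set (minkCone n a) :=
  {q | (q : Mink n).2 ^ 2 - ‖(q : Mink n).1‖ ^ 2 = ρ ^ 2}

/-- The `n`-dimensional area of `minkSlice n a ρ` for the induced Riemannian metric, computed in its
parametrization `x ↦ ρ (x, √(1 + ‖x‖²))`, `‖x‖ ≤ a`. -/
def minkSliceArea (n : ℕ) (a ρ : ℝ) : ENNReal :=
  paramVolume (minkForm n) (eucBasis n) (fun x => ρ • hyp n x) (Metric.closedBall 0 a)
    (Subtype.val '' minkSlice n a ρ)

/-! ### De Sitter and anti-de Sitter spaces -/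

/-- Points `(x, t, w)` of the ambient space `ℝⁿ × ℝ × ℝ`. -/
abbrev Amb (n : ℕ) := Euc n × ℝ × ℝ

/-- `x · x' - t t' + w w'`. -/
def dSForm (n : ℕ) (u v : Amb n) : ℝ := inner ℝ u.1 v.1 - u.2.1 * v.2.1 + u.2.2 * v.2.2

/-- `x · x' - t t' - w w'`. -/
def adSForm (n : ℕ) (u v : Amb n) : ℝ := inner ℝ u.1 v.1 - u.2.1 * v.2.1 - u.2.2 * v.2.2

/-- The `(n+1)`-dimensional de Sitter space of constant sectional curvature `k > 0`. -/
def deSitter (n : ℕ) (k : ℝ) : Set (Amb n) := {q | dSForm n q q = 1 / k}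

/-- The `(n+1)`-dimensional anti-de Sitter space of constant sectional curvature `k < 0`. -/
def antiDeSitter (n : ℕ) (k : ℝ) : Set (Amb n) := {q | adSForm n q q = 1 / k}

/-- Time orientation of de Sitter space: `∂_t` (whose inner product with a tangent vector is that of
its projection to the tangent space). -/
def dSTime (n : ℕ) : Amb n → Amb n := fun _ => (0, 1, 0)

/-- Time orientation of anti-de Sitter space: the rotation field `w ∂_t - t ∂_w`. -/
def adSTime (n : ℕ) : Amb n → Amb n := fun q => (0, q.2.2, -q.2.1)

/-- `exp_p (r u)` for the base point `p = (0, 0, 1/√|κ|)` of the de Sitter (`κ < 0`) or anti-de Sitter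
(`κ > 0`) space of sectional curvature `-κ` and a unit timelike vector `u`, tangent at `p`:
this is `𝔠_κ(r) p + 𝔰_κ(r) u`. -/
def expPt (n : ℕ) (κ r : ℝ) (u : Mink n) : Amb n :=
  (sn κ r • u.1, sn κ r * u.2, cs κ r / Real.sqrt |κ|)

/-- The radii `r` with `0 < r < T_κ`, where `T_κ` is the first positive zero of `𝔰_κ`
(`∞` if there is none). -/
def radii (κ : ℝ) : Set ℝ := {r | 0 < r ∧ (0 < κ → r < Real.pi / Real.sqrt κ)}

/-- The conical region of the quadric `Q` with tip `p` spanned by the geodesics issuing from `p` in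
the directions of `hypCap n a`, up to the first conjugate point if there is one. -/
def quadricCone (n : ℕ) (Q : Set (Amb n)) (κ a : ℝ) : Set (Amb n) :=
  {q ∈ Q | ∃ r, (r = 0 ∨ r ∈ radii κ) ∧ ∃ u ∈ hypCap n a, q = expPt n κ r u}

/-- The standard basis of `ℝ × ℝⁿ`. -/
def polarBasis (n : ℕ) : Unit ⊕ Fin n → ℝ × Euc n :=
  Sum.elim (fun _ => (1, 0)) (fun i => (0, eucBasis n i))

/-- The volume measure of the quadric on `{exp_p (r u)}`, `r` in `radii κ`, `u` a future unit
timelike vector, written in the geodesic polar coordinates `(r, x) ↦ exp_p (r (x, √(1 + ‖x‖²)))`. -/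
def quadricVolume (n : ℕ) (B : Amb n → Amb n → ℝ) (κ : ℝ) : Measure (Amb n) :=
  paramVolume B (polarBasis n) (fun z => expPt n κ z.1 (hyp n z.2)) (radii κ ×ˢ univ)

/-- A conical region in anti-de Sitter space of sectional curvature `-κ < 0`. -/
def adSSpace (n : ℕ) (κ a : ℝ) : Space (quadricCone n (antiDeSitter n (-κ)) κ a) :=
  regionSpace (adSForm n) (adSTime n) (quadricVolume n (adSForm n) κ) _

/-- A conical region in de Sitter space of sectional curvature `-κ > 0`. -/
def dSSpace (n : ℕ) (κ a : ℝ) : Space (quadricCone n (deSitter n (-κ)) κ a) :=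
  regionSpace (dSForm n) (dSTime n) (quadricVolume n (dSForm n) κ) _

/-- The tip `p` of the conical region. -/
def quadricTip (n : ℕ) (Q : Set (Amb n)) (κ a : ℝ) : Set (quadricCone n Q κ a) :=
  {q | (q : Amb n) = (0, 0, 1 / Real.sqrt |κ|)}

/-- The points `exp_p (ρ u)`, `u ∈ hypCap n a`, of the conical region. -/
def quadricSlice (n : ℕ) (Q : Set (Amb n)) (κ a ρ : ℝ) : Set (quadricCone n Q κ a) :=
  {q | ∃ u ∈ hypCap n a, (q : Amb n) = expPt n κ ρ u}

/-- The `n`-dimensional area of `quadricSlice n Q κ a ρ` for the Riemannian metric induced by `B`,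
computed in its parametrization `x ↦ exp_p (ρ (x, √(1 + ‖x‖²)))`, `‖x‖ ≤ a`. -/
def quadricSliceArea (n : ℕ) (B : Amb n → Amb n → ℝ) (Q : Set (Amb n)) (κ a ρ : ℝ) : ENNReal :=
  paramVolume B (eucBasis n) (fun x => expPt n κ ρ (hyp n x)) (Metric.closedBall 0 a)
    (Subtype.val '' quadricSlice n Q κ a ρ)

/-- The pair `(V, S)` is admissible, `S` lies at distance `ρ` from `V`, the area of `S`, i.e. its
future Minkowski content, is `A`, and nontrivial equality holds in the isoperimetric-type inequality
`𝔪⁺(S) 𝔇_{K,N}(dist(V,S)) ≤ 𝔪(C(V,S))`. -/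
structure AttainsEquality {X : Type*} [TopologicalSpace X] [MeasurableSpace X] (L : Space X)
    (K : ℝ) (N : ℕ) (V S : Set X) (ρ : ℝ) (A : ENNReal) : Prop where
  admissible : L.Admissible V S
  dist_eq : L.dist V S = (ρ : EReal)
  content_eq_area : L.minkowskiContent S = A
  vol_pos : 0 < L.vol (L.cone V S)
  vol_lt_top : L.vol (L.cone V S) < ⊤
  equality :
    L.minkowskiContent S * ENNReal.ofReal (DKN K N (L.dist V S).toReal) = L.vol (L.cone V S)

end LorentzIsop

end

open Set Filter Topology MeasureTheory

noncomputable section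

namespace LorentzIsop

/-!
In geodesic polar coordinates about the tip, the metric of each of the three regions is
`-dr² + s_κ(r)² g_ℍ`, so `r` is a time function whose gradient is a unit vector. By the reverse
Cauchy-Schwarz inequality the length of a causal curve is at most the increase of `r` along it, with
equality on the radial curves. Hence `τ_S = r - ρ` to the future of `S = {r = ρ}`; writing `ω` for
the volume of the spherical cap of hyperbolic space over which the region is a cone,
`𝔪⁺(S) = ω s_κ(ρ)ⁿ` by the fundamental theorem of calculus, while `C(V, S) = {r ≤ ρ}` has volume
`ω ∫₀^ρ s_κⁿ`.

As `r` is not smooth at the tip, it enters only as `r = h⁻¹ ∘ g` with `g` smooth on the ambient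
space: `g = t² - ‖x‖²` for `K = 0`, and `g = ∓w` on the quadrics.
-/

/-! ### Steep time functions -/

theorem monotoneOn_of_ae_deriv_nonneg {f : ℝ → ℝ} {a b : ℝ} (hab : a ≤ b)
    (hf : AbsolutelyContinuousOnInterval f a b)
    (hf' : ∀ᵐ s ∂(volume.restrict (Icc a b)), 0 ≤ deriv f s) : MonotoneOn f (Icc a b) := by
  intro x hx y hy hxy
  have hsub : Icc x y ⊆ Icc a b := Icc_subset_Icc hx.1 hy.2
  have hfxy : AbsolutelyContinuousOnInterval f x y :=
    hf.mono (by rwa [uIcc_of_le hab, uIcc_of_le hxy])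
  rw [← sub_nonneg, ← hfxy.integral_deriv_eq_sub]
  exact intervalIntegral.integral_nonneg_of_ae_restrict hxy
    (ae_restrict_of_ae_restrict_of_subset hsub hf')

theorem lintegral_deriv_le_of_monotoneOn {f : ℝ → ℝ} {a b : ℝ} (hab : a ≤ b)
    (hf : MonotoneOn f (Icc a b)) :
    ∫⁻ s in Icc a b, ENNReal.ofReal (deriv f s) ≤ ENNReal.ofReal (f b - f a) := by
  rw [← uIcc_of_le hab] at hf
  have hint : IntegrableOn (deriv f) (Icc a b) :=
    (intervalIntegrable_iff_integrableOn_Icc_of_le hab).1 hf.intervalIntegrable_deriv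
  have hnonneg : ∀ᵐ s ∂(volume.restrict (Icc a b)), 0 ≤ deriv f s := by
    rw [← restrict_Ioo_eq_restrict_Icc]
    filter_upwards [ae_restrict_mem measurableSet_Ioo] with s hs
    have hnhds : uIcc a b ∈ 𝓝 s := by
      rw [uIcc_of_le hab]
      exact Icc_mem_nhds hs.1 hs.2
    rw [← derivWithin_of_mem_nhds hnhds]
    exact hf.derivWithin_nonneg
  rw [← ofReal_integral_eq_lintegral_ofReal hint hnonneg, integral_Icc_eq_integral_Ioc,
    ← intervalIntegral.integral_of_le hab]
  refine ENNReal.ofReal_le_ofReal ?_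
  have hmem := hf.intervalIntegral_deriv_mem_uIcc
  have hfab : f a ≤ f b := hf left_mem_uIcc right_mem_uIcc hab
  rw [uIcc_of_le (sub_nonneg.2 hfab)] at hmem
  exact hmem.2

section Curves

variable {W : Type*} [NormedAddCommGroup W] [NormedSpace ℝ W]

theorem absolutelyContinuousOnInterval_comp {g : W → ℝ} (hg : ContDiff ℝ 1 g) {γ : ℝ → W}
    {C : NNReal} {a b : ℝ} (hγ : LipschitzOnWith C γ (uIcc a b)) :
    AbsolutelyContinuousOnInterval (g ∘ γ) a b := by
  obtain ⟨D, hD⟩ := LocallyLipschitzOn.exists_lipschitzOnWith_of_compact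
    (isCompact_uIcc.image_of_continuousOn hγ.continuousOn) hg.locallyLipschitz.locallyLipschitzOn
  exact (hD.comp hγ (mapsTo_image _ _)).absolutelyContinuousOnInterval

/-- `v` is the velocity at time `s` of the curve `γ`, which stays in `X` near `s`, and `v` is causal
and future directed. Such vectors play the role of the tangent vectors of the region `X`, which is
not assumed to be a manifold. -/
structure IsFutureVelocity (B : W → W → ℝ) (T : W → W) (X : Set W) (γ : ℝ → W) (s : ℝ) (v : W) :
    Prop where
  mem_nhds : ∀ᶠ s' in 𝓝 s, γ s' ∈ X
  hasDerivAt : HasDerivAt γ v s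
  causal : B v v ≤ 0
  future : B (T (γ s)) v < 0

variable {B : W → W → ℝ} {T : W → W} {X : Set W} {γ : ℝ → W}

theorem IsFutureVelocity.ne_zero (hB : ∀ q, B q 0 = 0) {s : ℝ} {v : W}
    (h : IsFutureVelocity B T X γ s v) : v ≠ 0 := by
  rintro rfl
  exact (hB (T (γ s)) ▸ h.future).false

theorem IsCausalCurve.ae_isFutureVelocity (hB : ∀ q, B q 0 = 0) (hγ : IsCausalCurve B T X γ) :
    ∀ᵐ s ∂(volume.restrict (Icc (0 : ℝ) 1)),
      s ∈ Ioo (0 : ℝ) 1 ∧ IsFutureVelocity B T X γ s (deriv γ s) := by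
  obtain ⟨-, hX, hae⟩ := hγ
  rw [← restrict_Ioo_eq_restrict_Icc] at hae ⊢
  filter_upwards [hae, ae_restrict_mem measurableSet_Ioo] with s hs hs01
  refine ⟨hs01, ?_, ?_, hs.1, hs.2⟩
  · filter_upwards [Icc_mem_nhds hs01.1 hs01.2] with s' hs' using hX s' hs'
  · refine DifferentiableAt.hasDerivAt (not_imp_comm.1 deriv_zero_of_not_differentiableAt ?_)
    intro hderiv_zero
    exact (hB (T (γ s)) ▸ hderiv_zero ▸ hs.2).false

theorem IsTimelikeCurve.isCausalCurve (hγ : IsTimelikeCurve B T X γ) : IsCausalCurve B T X γ :=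
  ⟨hγ.1, hγ.2.1, hγ.2.2.mono fun _ h => ⟨h.1.le, h.2⟩⟩

/-- A time function `ψ ∘ g` on `X` whose gradient has Lorentzian norm at least one away from its
unique minimum point `p`. It is written as `ψ ∘ g` because the radius about the tip of a cone is not
differentiable at the tip, whereas it is a function `ψ` of a function `g` smooth everywhere. -/
structure IsSteepTime (B : W → W → ℝ) (T : W → W) (X : Set W) (p : W) (g : W → ℝ) (ψ ψ' : ℝ → ℝ) :
    Prop where
  form_zero : ∀ q, B q 0 = 0
  contDiff : ContDiff ℝ 1 g
  strictMono : StrictMonoOn ψ (g '' X)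
  hasDerivAt : ∀ q ∈ X, q ≠ p → HasDerivAt ψ (ψ' (g q)) (g q)
  lt_of_ne : ∀ q ∈ X, q ≠ p → g p < g q
  grad : ∀ {γ : ℝ → W} {s : ℝ} {v : W}, IsFutureVelocity B T X γ s v → γ s ≠ p →
    0 < fderiv ℝ g (γ s) v ∧ Real.sqrt (-B v v) ≤ ψ' (g (γ s)) * fderiv ℝ g (γ s) v

namespace IsSteepTime

variable {p : W} {g : W → ℝ} {ψ ψ' : ℝ → ℝ} (H : IsSteepTime B T X p g ψ ψ')

include H

theorem hasDerivAt_comp {v : W} {s : ℝ} (h : HasDerivAt γ v s) :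
    HasDerivAt (g ∘ γ) (fderiv ℝ g (γ s) v) s :=
  ((H.contDiff.differentiable one_ne_zero (γ s)).hasFDerivAt).comp_hasDerivAt s h

theorem tip_le {q : W} (hq : q ∈ X) : g p ≤ g q := by
  rcases eq_or_ne q p with rfl | h
  exacts [le_rfl, (H.lt_of_ne q hq h).le]

theorem deriv_nonneg {s : ℝ} (h : IsFutureVelocity B T X γ s (deriv γ s)) :
    0 ≤ deriv (g ∘ γ) s := by
  by_cases hp : γ s = p
  · have hmin : IsLocalMin (g ∘ γ) s := by
      filter_upwards [h.mem_nhds] with s' hs'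
      simpa only [Function.comp_apply, hp] using H.tip_le hs'
    rw [hmin.deriv_eq_zero]
  · rw [(H.hasDerivAt_comp h.hasDerivAt).deriv]
    exact (H.grad h hp).1.le

theorem monotoneOn_comp (hγ : IsCausalCurve B T X γ) : MonotoneOn (g ∘ γ) (Icc 0 1) := by
  obtain ⟨C, hC⟩ := hγ.1
  rw [← uIcc_of_le zero_le_one] at hC
  refine monotoneOn_of_ae_deriv_nonneg zero_le_one
    (absolutelyContinuousOnInterval_comp H.contDiff hC) ?_
  filter_upwards [hγ.ae_isFutureVelocity H.form_zero] with s hs using H.deriv_nonneg hs.2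

-- A curve at the tip at time `s` has stayed there since time `0`, so its velocity vanishes.
theorem ne_tip (hγ : IsCausalCurve B T X γ) {s : ℝ} (hs : s ∈ Ioo (0 : ℝ) 1)
    (h : IsFutureVelocity B T X γ s (deriv γ s)) : γ s ≠ p := by
  intro hsp
  have hconst : ∀ s' ∈ Icc 0 s, γ s' = p := by
    intro s' hs'
    have hs'1 : s' ∈ Icc (0 : ℝ) 1 := ⟨hs'.1, hs'.2.trans hs.2.le⟩
    by_contra hne
    have hle : g (γ s') ≤ g (γ s) :=
      H.monotoneOn_comp hγ hs'1 (Ioo_subset_Icc_self hs) hs'.2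
    exact (H.lt_of_ne _ (hγ.2.1 s' hs'1) hne).not_ge (hsp ▸ hle)
  have hmem : s ∈ Icc 0 s := right_mem_Icc.2 hs.1.le
  have hderiv : HasDerivWithinAt γ 0 (Icc 0 s) s :=
    (hasDerivWithinAt_const s _ p).congr hconst (hconst s hmem)
  exact h.ne_zero H.form_zero
    ((uniqueDiffOn_Icc hs.1 s hmem).eq_deriv _ h.hasDerivAt.hasDerivWithinAt hderiv)

theorem ae_deriv (hγ : IsCausalCurve B T X γ) :
    ∀ᵐ s ∂(volume.restrict (Icc (0 : ℝ) 1)), s ∈ Ioo (0 : ℝ) 1 ∧ 0 < deriv (g ∘ γ) s ∧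
      Real.sqrt (-B (deriv γ s) (deriv γ s)) ≤ deriv (ψ ∘ g ∘ γ) s := by
  filter_upwards [hγ.ae_isFutureVelocity H.form_zero] with s hs
  have hne := H.ne_tip hγ hs.1 hs.2
  have hg := H.hasDerivAt_comp hs.2.hasDerivAt
  have hψ : HasDerivAt (ψ ∘ g ∘ γ) _ s :=
    (H.hasDerivAt _ (hγ.2.1 s (Ioo_subset_Icc_self hs.1)) hne).comp s hg
  rw [hg.deriv, hψ.deriv]
  exact ⟨hs.1, H.grad hs.2 hne⟩

theorem lt_of_causal (hγ : IsCausalCurve B T X γ) : ψ (g (γ 0)) < ψ (g (γ 1)) := by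
  have hmono := H.monotoneOn_comp hγ
  have hzero : (0 : ℝ) ∈ Icc (0 : ℝ) 1 := left_mem_Icc.2 zero_le_one
  have hone : (1 : ℝ) ∈ Icc (0 : ℝ) 1 := right_mem_Icc.2 zero_le_one
  refine H.strictMono (mem_image_of_mem _ (hγ.2.1 0 hzero)) (mem_image_of_mem _ (hγ.2.1 1 hone))
    ((hmono hzero hone zero_le_one).lt_of_ne fun heq => ?_)
  have hconst : ∀ s ∈ Icc (0 : ℝ) 1, (g ∘ γ) s = g (γ 0) := fun s hs =>
    le_antisymm ((hmono hs hone hs.2).trans_eq heq.symm) (hmono hzero hs hs.1)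
  have : (ae (volume.restrict (Icc (0 : ℝ) 1))).NeBot := by
    rw [ae_restrict_neBot]
    simp
  obtain ⟨s, hs, hpos, -⟩ := (H.ae_deriv hγ).exists
  have hloc : g ∘ γ =ᶠ[𝓝 s] fun _ => g (γ 0) := by
    filter_upwards [Icc_mem_nhds hs.1 hs.2] with s' hs' using hconst s' hs'
  rw [hloc.deriv_eq, deriv_const] at hpos
  exact hpos.false

theorem properTime_le (hγ : IsTimelikeCurve B T X γ) :
    properTime B γ ≤ ENNReal.ofReal (ψ (g (γ 1)) - ψ (g (γ 0))) := by
  have hγ' := hγ.isCausalCurve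
  have hmono : MonotoneOn (ψ ∘ g ∘ γ) (Icc 0 1) := fun s hs t ht hst =>
    H.strictMono.monotoneOn (mem_image_of_mem _ (hγ.2.1 s hs)) (mem_image_of_mem _ (hγ.2.1 t ht))
      (H.monotoneOn_comp hγ' hs ht hst)
  refine (lintegral_mono_ae ?_).trans (lintegral_deriv_le_of_monotoneOn zero_le_one hmono)
  filter_upwards [H.ae_deriv hγ'] with s hs using ENNReal.ofReal_le_ofReal hs.2.2

end IsSteepTime

end Curves

/-! ### Comparison functions -/

section Comparison

variable {κ r s : ℝ}

theorem sn_of_pos (hκ : 0 < κ) : sn κ = fun r => Real.sin (Real.sqrt κ * r) / Real.sqrt κ := by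
  ext r
  rw [sn, if_pos hκ]

theorem sn_of_neg (hκ : κ < 0) :
    sn κ = fun r => Real.sinh (Real.sqrt (-κ) * r) / Real.sqrt (-κ) := by
  ext r
  rw [sn, if_neg hκ.not_gt, if_pos hκ]

theorem sn_zero_left (r : ℝ) : sn 0 r = r := by simp [sn]

theorem cs_of_pos (hκ : 0 < κ) : cs κ = fun r => Real.cos (Real.sqrt κ * r) := by
  ext r
  rw [cs, if_pos hκ]

theorem cs_of_neg (hκ : κ < 0) : cs κ = fun r => Real.cosh (Real.sqrt (-κ) * r) := by
  ext r
  rw [cs, if_neg hκ.not_gt, if_pos hκ]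

theorem cs_zero_left (r : ℝ) : cs 0 r = 1 := by simp [cs]

theorem sn_zero (κ : ℝ) : sn κ 0 = 0 := by
  unfold sn
  split_ifs <;> simp

theorem cs_zero (κ : ℝ) : cs κ 0 = 1 := by
  unfold cs
  split_ifs <;> simp

theorem hasDerivAt_sn (κ r : ℝ) : HasDerivAt (sn κ) (cs κ r) r := by
  have hlin : ∀ k : ℝ, HasDerivAt (fun r : ℝ => k * r) k r := hasDerivAt_const_mul
  rcases lt_trichotomy κ 0 with hκ | rfl | hκ
  · have hsqrt : Real.sqrt (-κ) ≠ 0 := (Real.sqrt_pos.2 (neg_pos.2 hκ)).ne'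
    simpa only [sn_of_neg hκ, cs_of_neg hκ, mul_div_cancel_right₀ _ hsqrt] using
      (hlin (Real.sqrt (-κ))).sinh.div_const (Real.sqrt (-κ))
  · rw [cs_zero_left, funext sn_zero_left]
    exact hasDerivAt_id r
  · have hsqrt : Real.sqrt κ ≠ 0 := (Real.sqrt_pos.2 hκ).ne'
    simpa only [sn_of_pos hκ, cs_of_pos hκ, mul_div_cancel_right₀ _ hsqrt] using
      (hlin (Real.sqrt κ)).sin.div_const (Real.sqrt κ)

theorem hasDerivAt_cs (κ r : ℝ) : HasDerivAt (cs κ) (-κ * sn κ r) r := by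
  have hlin : ∀ k : ℝ, HasDerivAt (fun r : ℝ => k * r) k r := hasDerivAt_const_mul
  rcases lt_trichotomy κ 0 with hκ | rfl | hκ
  · have hsq := Real.mul_self_sqrt (neg_nonneg.2 hκ.le)
    have hsqrt : Real.sqrt (-κ) ≠ 0 := (Real.sqrt_pos.2 (neg_pos.2 hκ)).ne'
    rw [sn_of_neg hκ, cs_of_neg hκ]
    refine (hlin (Real.sqrt (-κ))).cosh.congr_deriv ?_
    field_simp
    linear_combination Real.sinh (Real.sqrt (-κ) * r) * hsq
  · rw [neg_zero, zero_mul, funext cs_zero_left]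
    exact hasDerivAt_const r 1
  · have hsq := Real.mul_self_sqrt hκ.le
    have hsqrt : Real.sqrt κ ≠ 0 := (Real.sqrt_pos.2 hκ).ne'
    rw [sn_of_pos hκ, cs_of_pos hκ]
    refine (hlin (Real.sqrt κ)).cos.congr_deriv ?_
    field_simp
    linear_combination -Real.sin (Real.sqrt κ * r) * hsq

theorem cs_sq_add (κ r : ℝ) : cs κ r ^ 2 + κ * sn κ r ^ 2 = 1 := by
  rcases lt_trichotomy κ 0 with hκ | rfl | hκ
  · simp only [sn_of_neg hκ, cs_of_neg hκ, div_pow, Real.sq_sqrt (neg_nonneg.2 hκ.le)]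
    rw [div_neg, mul_neg, mul_div_cancel₀ _ hκ.ne, Real.cosh_sq]
    ring
  · rw [cs_zero_left, zero_mul, add_zero, one_pow]
  · simp only [sn_of_pos hκ, cs_of_pos hκ, div_pow, Real.sq_sqrt hκ.le]
    rw [mul_div_cancel₀ _ hκ.ne', Real.cos_sq_add_sin_sq]

theorem continuous_sn (κ : ℝ) : Continuous (sn κ) :=
  continuous_iff_continuousAt.2 fun r => (hasDerivAt_sn κ r).continuousAt

theorem sn_pos (hr : r ∈ radii κ) : 0 < sn κ r := by
  obtain ⟨hr, hrπ⟩ := hr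
  unfold sn
  split_ifs with hκ hκ'
  · have hsqrt : 0 < Real.sqrt κ := Real.sqrt_pos.2 hκ
    refine div_pos (Real.sin_pos_of_pos_of_lt_pi (by positivity) ?_) hsqrt
    rw [mul_comm]
    exact (lt_div_iff₀ hsqrt).1 (hrπ hκ)
  · have hsqrt : 0 < Real.sqrt (-κ) := Real.sqrt_pos.2 (neg_pos.2 hκ')
    exact div_pos (Real.sinh_pos_iff.2 (by positivity)) hsqrt
  · exact hr

theorem mem_radii_of_le (hr : r ∈ radii κ) (hs : 0 < s) (hsr : s ≤ r) : s ∈ radii κ :=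
  ⟨hs, fun hκ => hsr.trans_lt (hr.2 hκ)⟩

theorem isOpen_radii (κ : ℝ) : IsOpen (radii κ) := by
  by_cases hκ : 0 < κ
  · have : radii κ = Ioo 0 (Real.pi / Real.sqrt κ) := by ext; simp [radii, hκ]
    exact this ▸ isOpen_Ioo
  · have : radii κ = Ioi 0 := by ext; simp [radii, hκ]
    exact this ▸ isOpen_Ioi

/-- The half-open interval `[0, T_κ)` of radii, the tip `r = 0` included. -/
def radii₀ (κ : ℝ) : Set ℝ := insert 0 (radii κ)

theorem zero_mem_radii₀ (κ : ℝ) : 0 ∈ radii₀ κ := mem_insert _ _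

theorem radii_subset_radii₀ (κ : ℝ) : radii κ ⊆ radii₀ κ := subset_insert _ _

theorem nonneg_of_mem_radii₀ (hr : r ∈ radii₀ κ) : 0 ≤ r := by
  rcases hr with rfl | hr
  exacts [le_rfl, hr.1.le]

theorem mem_radii_of_mem_radii₀ (hr : r ∈ radii₀ κ) (hne : r ≠ 0) : r ∈ radii κ :=
  hr.resolve_left hne

theorem mem_radii₀_of_le (hr : r ∈ radii₀ κ) (hs : 0 ≤ s) (hsr : s ≤ r) : s ∈ radii₀ κ := by
  rcases hs.eq_or_lt with rfl | hs
  · exact zero_mem_radii₀ κ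
  · exact Or.inr (mem_radii_of_le (mem_radii_of_mem_radii₀ hr (hs.trans_le hsr).ne') hs hsr)

theorem mul_mem_radii₀ (hr : r ∈ radii κ) (t : unitInterval) : (t : ℝ) * r ∈ radii₀ κ :=
  mem_radii₀_of_le (radii_subset_radii₀ κ hr) (mul_nonneg t.2.1 hr.1.le)
    (mul_le_of_le_one_left hr.1.le t.2.2)

theorem eventually_Icc_subset_radii (hr : r ∈ radii κ) :
    ∀ᶠ ε in 𝓝[>] (0 : ℝ), Icc r (r + ε) ⊆ radii κ := by
  have hmem : ∀ᶠ ε in 𝓝 (0 : ℝ), r + ε ∈ radii κ := by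
    have : Tendsto (fun ε : ℝ => r + ε) (𝓝 0) (𝓝 r) := by
      simpa only [add_zero] using (continuous_const_add r).tendsto 0
    exact this.eventually ((isOpen_radii κ).mem_nhds hr)
  filter_upwards [nhdsWithin_le_nhds hmem] with ε hε s hs
  exact mem_radii_of_le hε (hr.1.trans_le hs.1) hs.2

theorem lintegral_sn_pow (hr : 0 ≤ r) (hrs : r ≤ s) (hs : s ∈ radii κ) (n : ℕ) :
    ∫⁻ u in Ioc r s, ENNReal.ofReal (sn κ u ^ n) = ENNReal.ofReal (∫ u in r..s, sn κ u ^ n) := by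
  rw [intervalIntegral.integral_of_le hrs, ofReal_integral_eq_lintegral_ofReal]
  · exact ((continuous_sn κ).pow n).integrableOn_Icc.mono_set Ioc_subset_Icc_self
  · filter_upwards [ae_restrict_mem measurableSet_Ioc] with u hu
    exact pow_nonneg (sn_pos (mem_radii_of_le hs (hr.trans_lt hu.1) hu.2)).le n

theorem integral_sn_pow_pos (hr : r ∈ radii κ) (n : ℕ) : 0 < ∫ s in (0 : ℝ)..r, sn κ s ^ n :=
  intervalIntegral.intervalIntegral_pos_of_pos_on
    (((continuous_sn κ).pow n).intervalIntegrable _ _)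
    (fun _ hs => pow_pos (sn_pos (mem_radii_of_le hr hs.1 hs.2.le)) n) hr.1

end Comparison

/-! ### Spaces with geodesic polar coordinates -/

theorem sum_succ_sub_castSucc {G : Type*} [AddCommGroup G] {k : ℕ} (t : Fin (k + 1) → G) :
    ∑ i : Fin k, (t i.succ - t i.castSucc) = t (Fin.last k) - t 0 := by
  induction k with
  | zero => simp
  | succ k ih =>
    have hinit := ih fun i => t i.castSucc
    rw [Fin.castSucc_zero] at hinit
    simp only [Fin.sum_univ_castSucc, Fin.succ_castSucc, hinit, Fin.succ_last]
    abel

theorem Space.length_eq_of_mem_Geo {X : Type*} [TopologicalSpace X] [MeasurableSpace X]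
    {L : Space X} {γ : C(unitInterval, X)} (hγ : γ ∈ L.Geo) :
    L.length γ = L.τ (γ 0) (γ 1) := by
  have hsum : ∀ (k : ℕ) (t : Fin (k + 1) → unitInterval),
      StrictMono t ∧ t 0 = 0 ∧ t (Fin.last k) = 1 →
      ∑ i : Fin k, L.τ (γ (t i.castSucc)) (γ (t i.succ)) = L.τ (γ 0) (γ 1) := by
    rintro k t ⟨hmono, hzero, hlast⟩
    have hlt : ∀ i : Fin k, t i.castSucc < t i.succ := fun i => hmono Fin.castSucc_lt_succ
    rw [Finset.sum_congr rfl fun i _ => hγ _ _ (hlt i), ← Finset.sum_mul,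
      ← ENNReal.ofReal_sum_of_nonneg fun i _ => sub_nonneg.2 (hlt i).le,
      sum_succ_sub_castSucc fun i => (t i : ℝ), hzero, hlast]
    simp
  have htrivial : StrictMono (![0, 1] : Fin 2 → unitInterval) ∧
      (![0, 1] : Fin 2 → unitInterval) 0 = 0 ∧
      (![0, 1] : Fin 2 → unitInterval) (Fin.last 1) = 1 :=
    ⟨strictMono_vecCons.2 ⟨zero_lt_one, strictMono_vecEmpty⟩, rfl, rfl⟩
  apply le_antisymm
  · rw [← hsum 1 _ htrivial]
    exact iInf_le_of_le 1 <| iInf_le_of_le _ <| iInf_le_of_le htrivial le_rfl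
  · exact le_iInf fun k => le_iInf fun t => le_iInf fun ht => (hsum k t ht).ge

/-- Polar coordinates `E r x`, with `r` in `[0, T_κ)` and `x` in the compact set `D`, in which
radial lines realize the radius difference, an upper bound for the time separation, and the
measure is `𝔰_κ(r)ⁿ dr` times a measure of total mass `ω`. -/
structure PolarModel {X P : Type*} [TopologicalSpace X] [MeasurableSpace X] [TopologicalSpace P]
    (L : Space X) (n : ℕ) (κ : ℝ) (D : Set P) (ω : ENNReal) (rad : X → ℝ) (E : ℝ → P → X) :
    Prop where
  compact : IsCompact D
  nonempty : D.Nonempty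
  surj : ∀ q, ∃ r ∈ radii₀ κ, ∃ x ∈ D, E r x = q
  rad_E : ∀ r ∈ radii₀ κ, ∀ x ∈ D, rad (E r x) = r
  tip : ∀ x ∈ D, ∀ y ∈ D, E 0 x = E 0 y
  cont : ContinuousOn (fun z : ℝ × P => E z.1 z.2) (radii₀ κ ×ˢ D)
  rad_lt : ∀ q q', L.le q q' → q ≠ q' → rad q < rad q'
  τ_le : ∀ q q', L.τ q q' ≤ ENNReal.ofReal (rad q' - rad q)
  le_τ : ∀ r ∈ radii₀ κ, ∀ r' ∈ radii₀ κ, r < r' → ∀ x ∈ D,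
    ENNReal.ofReal (r' - r) ≤ L.τ (E r x) (E r' x)
  vol : ∀ J ⊆ radii κ, MeasurableSet J →
    L.vol {q | rad q ∈ J} = ω * ∫⁻ r in J, ENNReal.ofReal (sn κ r ^ n)
  vol_tip : L.vol {q | rad q = 0} = 0
  ω_ne_zero : ω ≠ 0
  ω_ne_top : ω ≠ ⊤

namespace PolarModel

variable {X P : Type*} [TopologicalSpace X] [MeasurableSpace X] [TopologicalSpace P]
  {L : Space X} {n : ℕ} {κ : ℝ} {D : Set P} {ω : ENNReal} {rad : X → ℝ} {E : ℝ → P → X}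
  (H : PolarModel L n κ D ω rad E) {c ρ r r' : ℝ} {q q' : X} {x : P}

include H

theorem τ_eq (hr : r ∈ radii₀ κ) (hr' : r' ∈ radii₀ κ) (hrr' : r ≤ r') (hx : x ∈ D) :
    L.τ (E r x) (E r' x) = ENNReal.ofReal (r' - r) := by
  have hle := H.τ_le (E r x) (E r' x)
  rw [H.rad_E r hr x hx, H.rad_E r' hr' x hx] at hle
  rcases hrr'.eq_or_lt with rfl | hlt
  · simpa only [sub_self, ENNReal.ofReal_zero, nonpos_iff_eq_zero] using hle
  · exact hle.antisymm (H.le_τ r hr r' hr' hlt x hx)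

theorem rad_lt_of_chron (h : L.chron q q') : rad q < rad q' :=
  sub_pos.1 (ENNReal.ofReal_pos.1 (h.trans_le (H.τ_le q q')))

theorem rad_mem (q : X) : rad q ∈ radii₀ κ := by
  obtain ⟨r, hr, x, hx, rfl⟩ := H.surj q
  rwa [H.rad_E r hr x hx]

theorem rad_nonneg (q : X) : 0 ≤ rad q := nonneg_of_mem_radii₀ (H.rad_mem q)

theorem exists_eq (q : X) : ∃ x ∈ D, E (rad q) x = q := by
  obtain ⟨r, hr, x, hx, rfl⟩ := H.surj q
  exact ⟨x, hx, by rw [H.rad_E r hr x hx]⟩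

theorem level_zero_subsingleton : {q | rad q = 0}.Subsingleton := by
  intro q (hq : rad q = 0) q' (hq' : rad q' = 0)
  obtain ⟨x, hx, hqx⟩ := H.exists_eq q
  obtain ⟨x', hx', hqx'⟩ := H.exists_eq q'
  rw [← hqx, ← hqx', hq, hq']
  exact H.tip x hx x' hx'

theorem mem_chronFuture_level (hc : c ∈ radii₀ κ) :
    q ∈ L.chronFuture {q | rad q = c} ↔ c < rad q := by
  constructor
  · rintro ⟨y, rfl, h⟩
    exact H.rad_lt_of_chron h
  · intro h
    obtain ⟨x, hx, hq⟩ := H.exists_eq q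
    refine ⟨E c x, H.rad_E c hc x hx, ?_⟩
    rw [Space.chron, ← hq, H.τ_eq hc (H.rad_mem q) h.le hx]
    exact ENNReal.ofReal_pos.2 (sub_pos.2 h)

theorem tauFrom_level (hc : c ∈ radii₀ κ) (h : c < rad q) :
    L.tauFrom {q | rad q = c} q = ((rad q - c : ℝ) : EReal) := by
  have hsup : (⨆ y ∈ {q | rad q = c}, L.τ y q) = ENNReal.ofReal (rad q - c) := by
    apply le_antisymm
    · refine iSup₂_le ?_
      rintro y rfl
      exact H.τ_le y q
    · obtain ⟨x, hx, hq⟩ := H.exists_eq q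
      have hτ := H.τ_eq hc (H.rad_mem q) h.le hx
      rw [hq] at hτ
      rw [← hτ]
      exact le_iSup₂ (f := fun y _ => L.τ y q) (E c x) (H.rad_E c hc x hx)
  rw [Space.tauFrom, if_pos ((H.mem_chronFuture_level hc).2 h), hsup, EReal.coe_ennreal_ofReal,
    max_eq_left (sub_nonneg.2 h.le)]

theorem tauFrom_level_nonpos (hc : c ∈ radii₀ κ) (h : rad q ≤ c) :
    L.tauFrom {q | rad q = c} q ≤ 0 := by
  rw [Space.tauFrom, if_neg (mt (H.mem_chronFuture_level hc).1 h.not_gt)]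
  split_ifs
  · exact EReal.neg_le_zero.2 (EReal.coe_ennreal_nonneg _)
  · exact le_rfl

theorem preimage_tauFrom_level (hc : c ∈ radii₀ κ) (ε : ℝ) :
    L.tauFrom {q | rad q = c} ⁻¹' Ioo (0 : EReal) (ε : EReal) = {q | rad q ∈ Ioo c (c + ε)} := by
  ext q
  rcases lt_or_ge c (rad q) with h | h
  · simp only [mem_preimage, H.tauFrom_level hc h, mem_Ioo, mem_ofPred_eq, EReal.coe_pos,
      EReal.coe_lt_coe_iff, sub_pos, sub_lt_iff_lt_add']
  · have hneg := (H.tauFrom_level_nonpos hc h).not_gt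
    simp only [mem_preimage, mem_Ioo, mem_ofPred_eq, hneg, h.not_gt, false_and]

theorem isCompact_level (hc : c ∈ radii₀ κ) : IsCompact {q | rad q = c} := by
  have himage : {q | rad q = c} = E c '' D := by
    ext q
    constructor
    · rintro rfl
      exact H.exists_eq q
    · rintro ⟨x, hx, rfl⟩
      exact H.rad_E c hc x hx
  rw [himage]
  exact H.compact.image_of_continuousOn
    (H.cont.comp (f := fun x => (c, x)) (by fun_prop) fun _ hx => ⟨hc, hx⟩)

theorem timelikeComplete_tip [T1Space X] : L.TimelikeComplete {q | rad q = 0} := by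
  have hinter : ∀ A : Set X, IsCompact (closure (A ∩ {q | rad q = 0})) ∧
      closure (A ∩ {q | rad q = 0}) ⊆ {q | rad q = 0} := by
    intro A
    have hsub : (A ∩ {q | rad q = 0}).Subsingleton :=
      H.level_zero_subsingleton.anti inter_subset_right
    rw [hsub.isClosed.closure_eq]
    exact ⟨hsub.finite.isCompact, inter_subset_right⟩
  exact ⟨fun _ _ => hinter _, fun _ _ => hinter _⟩

theorem level_subset_chronPast (hρ : ρ ∈ radii κ) : {q | rad q = ρ} ⊆ L.chronPast univ := by
  rintro q rfl
  obtain ⟨ε, hε, hpos : 0 < ε⟩ :=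
    ((eventually_Icc_subset_radii hρ).and self_mem_nhdsWithin).exists
  have hle : rad q ≤ rad q + ε := le_add_of_nonneg_right hpos.le
  obtain ⟨x, hx, hq⟩ := H.exists_eq q
  refine ⟨E (rad q + ε) x, mem_univ _, ?_⟩
  have hτ := H.τ_eq (H.rad_mem q) (radii_subset_radii₀ κ (hε ⟨hle, le_rfl⟩)) hle hx
  rw [hq, add_sub_cancel_left] at hτ
  rw [Space.chron, hτ]
  exact ENNReal.ofReal_pos.2 hpos

theorem admissible [T1Space X] [MeasurableSingletonClass X] (hρ : ρ ∈ radii κ) :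
    L.Admissible {q | rad q = 0} {q | rad q = ρ} where
  borel := H.level_zero_subsingleton.measurableSet
  achronal _ hx _ hy h := (H.rad_lt_of_chron h).ne (hx.trans hy.symm)
  timelikeComplete := H.timelikeComplete_tip
  compact := H.isCompact_level (radii_subset_radii₀ κ hρ)
  acausal x hx y hy h := by
    by_contra hne
    exact (H.rad_lt x y h hne).ne (hx.trans hy.symm)
  future q hq := (H.mem_chronFuture_level (zero_mem_radii₀ κ)).2 (hρ.1.trans_eq hq.symm)
  past := ⟨univ, H.level_subset_chronPast hρ⟩

theorem tauFrom_tip (hρ : ρ ∈ radii κ) (hq : rad q = ρ) :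
    L.tauFrom {q | rad q = 0} q = (ρ : EReal) := by
  rw [H.tauFrom_level (zero_mem_radii₀ κ) (hρ.1.trans_eq hq.symm), hq, sub_zero]

theorem dist_eq (hρ : ρ ∈ radii κ) : L.dist {q | rad q = 0} {q | rad q = ρ} = (ρ : EReal) := by
  obtain ⟨x, hx⟩ := H.nonempty
  have hE : rad (E ρ x) = ρ := H.rad_E ρ (radii_subset_radii₀ κ hρ) x hx
  apply le_antisymm
  · exact (iInf₂_le (E ρ x) hE).trans (H.tauFrom_tip hρ hE).le
  · exact le_iInf₂ fun q hq => (H.tauFrom_tip hρ hq).ge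

-- By compactness of `D`, the shells over the level shrink into every neighbourhood of the level.
theorem eventually_shell_subset (hρ : ρ ∈ radii κ) {U : Set X} (hU : IsOpen U)
    (hS : {q | rad q = ρ} ⊆ U) :
    ∀ᶠ ε in 𝓝[>] (0 : ℝ), {q | rad q ∈ Ioo ρ (ρ + ε)} ⊆ U := by
  have hρ₀ := radii_subset_radii₀ κ hρ
  have hnear : ∀ᶠ r in 𝓝 ρ, ∀ x ∈ D, x ∈ D → E r x ∈ U := by
    refine H.compact.eventually_forall_of_forall_eventually fun x hx => ?_
    have hEU : ∀ᶠ z in 𝓝[radii₀ κ ×ˢ D] (ρ, x), E z.1 z.2 ∈ U :=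
      (H.cont (ρ, x) ⟨hρ₀, hx⟩).eventually (hU.mem_nhds (hS (H.rad_E ρ hρ₀ x hx)))
    have hradii : ∀ᶠ z : ℝ × P in 𝓝 (ρ, x), z.1 ∈ radii κ :=
      continuous_fst.continuousAt.eventually ((isOpen_radii κ).mem_nhds hρ)
    filter_upwards [eventually_nhdsWithin_iff.1 hEU, hradii] with z hzU hzr hzD
    exact hzU ⟨radii_subset_radii₀ κ hzr, hzD⟩
  obtain ⟨δ, hδ, hball⟩ := Metric.eventually_nhds_iff.1 hnear
  filter_upwards [nhdsWithin_le_nhds (gt_mem_nhds hδ)] with ε hε q hq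
  obtain ⟨x, hx, hqx⟩ := H.exists_eq q
  rw [← hqx]
  refine hball ?_ x hx hx
  rw [Real.dist_eq, abs_lt]
  constructor <;> linarith [hq.1, hq.2]

theorem tendsto_vol_shell_div (hρ : ρ ∈ radii κ) :
    Tendsto (fun ε : ℝ => L.vol {q | rad q ∈ Ioo ρ (ρ + ε)} / ENNReal.ofReal ε)
      (𝓝[>] 0) (𝓝 (ω * ENNReal.ofReal (sn κ ρ ^ n))) := by
  have hcont := (continuous_sn κ).pow n
  have hderiv : HasDerivAt (fun u => ∫ s in ρ..u, sn κ s ^ n) (sn κ ρ ^ n) ρ :=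
    intervalIntegral.integral_hasDerivAt_right IntervalIntegrable.refl
      (hcont.stronglyMeasurableAtFilter _ _) hcont.continuousAt
  refine (ENNReal.Tendsto.const_mul (ENNReal.tendsto_ofReal hderiv.tendsto_slope_zero_right)
    (Or.inr H.ω_ne_top)).congr' ?_
  filter_upwards [eventually_Icc_subset_radii hρ, self_mem_nhdsWithin] with ε hε (hpos : 0 < ε)
  have hle : ρ ≤ ρ + ε := le_add_of_nonneg_right hpos.le
  rw [H.vol _ (Ioo_subset_Icc_self.trans hε) measurableSet_Ioo,
    setLIntegral_congr Ioo_ae_eq_Ioc,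
    lintegral_sn_pow hρ.1.le hle (hε ⟨hle, le_rfl⟩), mul_div_assoc,
    ← ENNReal.ofReal_div_of_pos hpos, intervalIntegral.integral_same, sub_zero, smul_eq_mul,
    div_eq_inv_mul]

theorem minkowskiContent_eq (hρ : ρ ∈ radii κ) :
    L.minkowskiContent {q | rad q = ρ} = ω * ENNReal.ofReal (sn κ ρ ^ n) := by
  have hlim := (H.tendsto_vol_shell_div hρ).limsup_eq
  simp only [Space.minkowskiContent, H.preimage_tauFrom_level (radii_subset_radii₀ κ hρ)]
  apply le_antisymm
  · refine (iInf₂_le univ ⟨isOpen_univ, subset_univ _⟩).trans ?_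
    simpa only [inter_univ] using hlim.le
  · refine le_iInf₂ fun U hU => ?_
    rw [← hlim]
    refine (limsup_congr ?_).le
    filter_upwards [H.eventually_shell_subset hρ hU.1 hU.2] with ε hε
    rw [inter_eq_left.2 hε]

/-- The radial geodesic from the tip to `E ρ x`, parametrized proportionally to the radius. -/
def radialGeodesic (hρ : ρ ∈ radii κ) (hx : x ∈ D) : C(unitInterval, X) where
  toFun t := E (t * ρ) x
  continuous_toFun := H.cont.comp_continuous (f := fun t : unitInterval => ((t : ℝ) * ρ, x))
    (by fun_prop) fun t => ⟨mul_mem_radii₀ hρ t, hx⟩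

theorem rad_radialGeodesic (hρ : ρ ∈ radii κ) (hx : x ∈ D) (t : unitInterval) :
    rad (H.radialGeodesic hρ hx t) = t * ρ :=
  H.rad_E _ (mul_mem_radii₀ hρ t) x hx

theorem τ_radialGeodesic (hρ : ρ ∈ radii κ) (hx : x ∈ D) {s t : unitInterval} (hst : s ≤ t) :
    L.τ (H.radialGeodesic hρ hx s) (H.radialGeodesic hρ hx t) =
      ENNReal.ofReal (((t : ℝ) - s) * ρ) := by
  rw [sub_mul]
  exact H.τ_eq (mul_mem_radii₀ hρ s) (mul_mem_radii₀ hρ t)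
    (mul_le_mul_of_nonneg_right hst hρ.1.le) hx

theorem τ_radialGeodesic_endpoints (hρ : ρ ∈ radii κ) (hx : x ∈ D) :
    L.τ (H.radialGeodesic hρ hx 0) (H.radialGeodesic hρ hx 1) = ENNReal.ofReal ρ := by
  simpa using H.τ_radialGeodesic hρ hx zero_le_one

theorem radialGeodesic_mem_Geo (hρ : ρ ∈ radii κ) (hx : x ∈ D) :
    H.radialGeodesic hρ hx ∈ L.Geo := fun _ _ hst => by
  rw [H.τ_radialGeodesic_endpoints, H.τ_radialGeodesic hρ hx hst.le,
    ENNReal.ofReal_mul (sub_nonneg.2 hst.le)]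

theorem cone_subset (hρ : ρ ∈ radii κ) :
    L.cone {q | rad q = 0} {q | rad q = ρ} ⊆ {q | rad q ≤ ρ} := by
  rintro _ ⟨γ, hγ, t, -, hγ1 : rad (γ 1) = ρ, hlen, rfl⟩
  rcases eq_or_ne t 1 with rfl | ht
  · exact hγ1.le
  have hτ : 0 < L.τ (γ 0) (γ 1) := by
    rw [Space.length_eq_of_mem_Geo hγ, H.tauFrom_tip hρ hγ1] at hlen
    rw [← EReal.coe_ennreal_pos, hlen]
    exact EReal.coe_pos.2 hρ.1
  have ht_lt : t < 1 := lt_of_le_of_ne t.2.2 ht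
  have hchron : L.chron (γ t) (γ 1) := by
    rw [Space.chron, hγ t 1 ht_lt]
    exact ENNReal.mul_pos (ENNReal.ofReal_pos.2 (sub_pos.2 ht_lt)).ne' hτ.ne'
  exact (H.rad_lt_of_chron hchron).le.trans_eq hγ1

theorem subset_cone (hρ : ρ ∈ radii κ) :
    {q | rad q ≤ ρ} ⊆ L.cone {q | rad q = 0} {q | rad q = ρ} := by
  intro q (hq : rad q ≤ ρ)
  obtain ⟨x, hx, hqx⟩ := H.exists_eq q
  have hrad := H.rad_radialGeodesic hρ hx
  have hrad_one : rad (H.radialGeodesic hρ hx 1) = ρ := by rw [hrad, Icc.coe_one, one_mul]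
  refine ⟨H.radialGeodesic hρ hx, H.radialGeodesic_mem_Geo hρ hx,
    ⟨rad q / ρ, div_nonneg (H.rad_nonneg q) hρ.1.le, div_le_one_of_le₀ hq hρ.1.le⟩,
    ?_, hrad_one, ?_, ?_⟩
  · exact (hrad 0).trans (zero_mul ρ)
  · rw [Space.length_eq_of_mem_Geo (H.radialGeodesic_mem_Geo hρ hx),
      H.τ_radialGeodesic_endpoints, H.tauFrom_tip hρ hrad_one, EReal.coe_ennreal_ofReal,
      max_eq_left hρ.1.le]
  · change q = E (rad q / ρ * ρ) x
    rw [div_mul_cancel₀ _ hρ.1.ne', hqx]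

theorem vol_cone (hρ : ρ ∈ radii κ) :
    L.vol (L.cone {q | rad q = 0} {q | rad q = ρ}) =
      ω * ENNReal.ofReal (∫ s in (0 : ℝ)..ρ, sn κ s ^ n) := by
  have hsplit : {q | rad q ≤ ρ} = {q | rad q = 0} ∪ {q | rad q ∈ Ioc 0 ρ} := by
    ext q
    simp only [mem_ofPred_eq, mem_union, mem_Ioc, (H.rad_nonneg q).lt_iff_ne,
      ne_comm (a := (0 : ℝ))]
    by_cases hrad_zero : rad q = 0 <;> simp [hrad_zero, hρ.1.le]
  rw [(H.cone_subset hρ).antisymm (H.subset_cone hρ), hsplit,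
    measure_congr (union_ae_eq_right.2 (measure_mono_null sdiff_subset H.vol_tip)),
    H.vol _ (fun r hr => mem_radii_of_le hρ hr.1 hr.2) measurableSet_Ioc,
    lintegral_sn_pow le_rfl hρ.1.le hρ]

theorem attainsEquality [T1Space X] [MeasurableSingletonClass X] {K : ℝ} {N : ℕ} {A : ENNReal}
    (hκ : κ = K / ((N : ℝ) - 1)) (hn : n = N - 1) (hρ : ρ ∈ radii κ)
    (hA : A = ω * ENNReal.ofReal (sn κ ρ ^ n)) :
    AttainsEquality L K N {q | rad q = 0} {q | rad q = ρ} ρ A where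
  admissible := H.admissible hρ
  dist_eq := H.dist_eq hρ
  content_eq_area := (H.minkowskiContent_eq hρ).trans hA.symm
  vol_pos := by
    rw [H.vol_cone hρ]
    exact ENNReal.mul_pos H.ω_ne_zero (ENNReal.ofReal_pos.2 (integral_sn_pow_pos hρ n)).ne'
  vol_lt_top := by
    rw [H.vol_cone hρ]
    exact ENNReal.mul_lt_top H.ω_ne_top.lt_top ENNReal.ofReal_lt_top
  equality := by
    have hpow : 0 < sn κ ρ ^ n := pow_pos (sn_pos hρ) n
    rw [H.vol_cone hρ, H.dist_eq hρ, EReal.toReal_coe, H.minkowskiContent_eq hρ, mul_assoc,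
      ← ENNReal.ofReal_mul hpow.le, DKN, ← hκ, ← hn, ← mul_assoc, mul_one_div_cancel hpow.ne',
      one_mul]

end PolarModel

/-! ### The unit hyperboloid -/

section Hyperboloid

variable {n : ℕ}

theorem hyp_form_self (x : Euc n) : (hyp n x).2 ^ 2 - ‖(hyp n x).1‖ ^ 2 = 1 := by
  simp only [hyp]
  rw [Real.sq_sqrt (by positivity), add_sub_cancel_right]

theorem hyp_snd_pos (x : Euc n) : 0 < (hyp n x).2 := Real.sqrt_pos.2 (by positivity)

theorem continuous_hyp : Continuous (hyp n) := by
  unfold hyp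
  fun_prop

theorem hypCap_eq_image (a : ℝ) : hypCap n a = hyp n '' Metric.closedBall 0 a := by
  ext u
  constructor
  · rintro ⟨hform, hpos, hnorm⟩
    refine ⟨u.1, mem_closedBall_zero_iff.2 hnorm, Prod.ext rfl ?_⟩
    rw [hyp, show 1 + ‖u.1‖ ^ 2 = u.2 ^ 2 by rw [← hform, sub_add_cancel], Real.sqrt_sq hpos.le]
  · rintro ⟨x, hx, rfl⟩
    exact ⟨hyp_form_self x, hyp_snd_pos x, mem_closedBall_zero_iff.1 hx⟩

theorem hasFDerivAt_hyp (x : Euc n) : HasFDerivAt (hyp n)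
    ((ContinuousLinearMap.id ℝ (Euc n)).prod ((Real.sqrt (1 + ‖x‖ ^ 2))⁻¹ • innerSL ℝ x)) x := by
  have hsq : HasFDerivAt (fun x : Euc n => 1 + ‖x‖ ^ 2) (2 • innerSL ℝ x) x :=
    (hasStrictFDerivAt_norm_sq x).hasFDerivAt.const_add 1
  refine ((hasFDerivAt_id x).prodMk (hsq.sqrt (by positivity))).congr_fderiv ?_
  congr 1
  ext v
  simp only [one_div, mul_inv_rev, smul_apply, coe_innerSL_apply, nsmul_eq_mul,
    Nat.cast_ofNat, smul_eq_mul]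
  field_simp

theorem fderiv_hyp_apply (x v : Euc n) :
    fderiv ℝ (hyp n) x v = (v, (Real.sqrt (1 + ‖x‖ ^ 2))⁻¹ * inner ℝ x v) := by
  rw [(hasFDerivAt_hyp x).fderiv]
  rfl

theorem minkForm_hyp_fderiv (x v : Euc n) : minkForm n (hyp n x) (fderiv ℝ (hyp n) x v) = 0 := by
  have hsqrt : Real.sqrt (1 + ‖x‖ ^ 2) ≠ 0 := (hyp_snd_pos x).ne'
  rw [fderiv_hyp_apply, minkForm, hyp, mul_inv_cancel_left₀ hsqrt, sub_self]

theorem minkForm_fderiv_hyp (x u v : Euc n) :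
    minkForm n (fderiv ℝ (hyp n) x u) (fderiv ℝ (hyp n) x v) =
      inner ℝ u v - (1 + ‖x‖ ^ 2)⁻¹ * (inner ℝ x u * inner ℝ x v) := by
  rw [fderiv_hyp_apply, fderiv_hyp_apply, minkForm, mul_mul_mul_comm, ← mul_inv,
    Real.mul_self_sqrt (by positivity)]

theorem gramMatrix_hyp (x : Euc n) :
    (Matrix.of fun i j => minkForm n (fderiv ℝ (hyp n) x (eucBasis n i))
      (fderiv ℝ (hyp n) x (eucBasis n j))) =
    1 + Matrix.replicateCol Unit (-(1 + ‖x‖ ^ 2)⁻¹ • x.ofLp) *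
      Matrix.replicateRow Unit x.ofLp := by
  ext i j
  have hij : inner ℝ (eucBasis n i) (eucBasis n j) = (1 : Matrix (Fin n) (Fin n) ℝ) i j := by
    simp [eucBasis, EuclideanSpace.inner_single_right, Matrix.one_apply, eq_comm]
  have hx : ∀ i, inner ℝ x (eucBasis n i) = x i := fun i => by
    simp [eucBasis, EuclideanSpace.inner_single_right]
  rw [Matrix.of_apply, minkForm_fderiv_hyp, hij, hx, hx]
  simp only [neg_smul, Matrix.add_apply, Matrix.mul_apply, Finset.univ_unique,
    Matrix.replicateCol_apply, Pi.neg_apply, Pi.smul_apply, smul_eq_mul,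
    Matrix.replicateRow_apply, neg_mul, Finset.sum_neg_distrib, Finset.sum_const,
    Finset.card_singleton, one_smul]
  ring

theorem gramDensity_hyp (x : Euc n) :
    gramDensity (minkForm n) (eucBasis n) (hyp n) x = (Real.sqrt (1 + ‖x‖ ^ 2))⁻¹ := by
  have hdot : dotProduct x.ofLp x.ofLp = ‖x‖ ^ 2 := by
    rw [EuclideanSpace.real_norm_sq_eq]
    exact Finset.sum_congr rfl fun i _ => (sq _).symm
  have hdet : 1 + -(1 + ‖x‖ ^ 2)⁻¹ * ‖x‖ ^ 2 = (1 + ‖x‖ ^ 2)⁻¹ := by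
    field_simp
    ring
  rw [gramDensity, gramMatrix_hyp, Matrix.det_one_add_replicateCol_mul_replicateRow,
    dotProduct_smul, hdot, smul_eq_mul, hdet, abs_of_pos (by positivity), Real.sqrt_inv]

/-- The hyperbolic volume of `hypCap n a`, in the parametrization `hyp n` of the hyperboloid. -/
def capVolume (n : ℕ) (a : ℝ) : ENNReal :=
  ∫⁻ x in Metric.closedBall (0 : Euc n) a, ENNReal.ofReal (Real.sqrt (1 + ‖x‖ ^ 2))⁻¹

theorem measurable_capDensity :
    Measurable fun x : Euc n => ENNReal.ofReal (Real.sqrt (1 + ‖x‖ ^ 2))⁻¹ := by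
  fun_prop

theorem capVolume_ne_top (a : ℝ) : capVolume n a ≠ ⊤ := by
  refine ne_top_of_le_ne_top
    (measure_closedBall_lt_top (μ := volume) (x := (0 : Euc n)) (r := a)).ne ?_
  rw [capVolume, ← setLIntegral_one]
  refine lintegral_mono fun x => ?_
  rw [ENNReal.ofReal_le_one]
  exact inv_le_one_of_one_le₀ (Real.one_le_sqrt.2 (le_add_of_nonneg_right (sq_nonneg _)))

theorem capVolume_ne_zero {a : ℝ} (ha : 0 < a) : capVolume n a ≠ 0 := by
  refine (setLIntegral_pos_iff measurable_capDensity).2 ?_ |>.ne'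
  have hsupp : Function.support
      (fun x : Euc n => ENNReal.ofReal (Real.sqrt (1 + ‖x‖ ^ 2))⁻¹) = univ :=
    Function.support_eq_univ fun x => (ENNReal.ofReal_pos.2 (by positivity)).ne'
  rw [hsupp, univ_inter]
  exact Metric.measure_closedBall_pos volume 0 ha

end Hyperboloid

/-! ### Parametrized volumes -/

section ParamVolume

variable {W : Type*} [NormedAddCommGroup W] [NormedSpace ℝ W] {B : W → W → ℝ}

theorem paramVolume_apply [MeasurableSpace W] {ι P : Type*} [Fintype ι] [DecidableEq ι]
    [NormedAddCommGroup P] [NormedSpace ℝ P] [MeasureSpace P] {b : ι → P} {Φ : P → W} {D : Set P}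
    (hΦ : Measurable Φ) {A : Set W} (hA : MeasurableSet A) :
    paramVolume B b Φ D A = ∫⁻ z in Φ ⁻¹' A ∩ D, ENNReal.ofReal (gramDensity B b Φ z) := by
  rw [paramVolume, Measure.map_apply hΦ hA, withDensity_apply _ (hΦ hA),
    Measure.restrict_restrict (hΦ hA)]

variable {n : ℕ} {Φ : Euc n → W} {c : ℝ}

theorem gramDensity_eq_of_conformal {x : Euc n} (hc : 0 ≤ c)
    (h : ∀ u v, B (fderiv ℝ Φ x u) (fderiv ℝ Φ x v) =
      c ^ 2 * minkForm n (fderiv ℝ (hyp n) x u) (fderiv ℝ (hyp n) x v)) :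
    gramDensity B (eucBasis n) Φ x = c ^ n * (Real.sqrt (1 + ‖x‖ ^ 2))⁻¹ := by
  have hsmul : (Matrix.of fun i j => B (fderiv ℝ Φ x (eucBasis n i))
      (fderiv ℝ Φ x (eucBasis n j))) = c ^ 2 • (Matrix.of fun i j =>
        minkForm n (fderiv ℝ (hyp n) x (eucBasis n i)) (fderiv ℝ (hyp n) x (eucBasis n j))) := by
    ext i j
    exact h _ _
  rw [← gramDensity_hyp, gramDensity, hsmul, Matrix.det_smul, abs_mul, Fintype.card_fin,
    abs_of_nonneg (by positivity), Real.sqrt_mul (by positivity), ← pow_mul, mul_comm 2 n, pow_mul,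
    Real.sqrt_sq (by positivity), gramDensity]

theorem lintegral_conformal (a : ℝ) (hc : 0 ≤ c) :
    ∫⁻ x in Metric.closedBall (0 : Euc n) a,
      ENNReal.ofReal (c ^ n * (Real.sqrt (1 + ‖x‖ ^ 2))⁻¹) =
    capVolume n a * ENNReal.ofReal (c ^ n) := by
  simp only [ENNReal.ofReal_mul (pow_nonneg hc n)]
  rw [lintegral_const_mul _ measurable_capDensity, mul_comm, capVolume]

theorem paramVolume_image_of_conformal [MeasurableSpace W] [BorelSpace W] (a : ℝ)
    (hc : 0 ≤ c) (hΦ : Continuous Φ)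
    (h : ∀ x u v, B (fderiv ℝ Φ x u) (fderiv ℝ Φ x v) =
      c ^ 2 * minkForm n (fderiv ℝ (hyp n) x u) (fderiv ℝ (hyp n) x v)) :
    paramVolume B (eucBasis n) Φ (Metric.closedBall 0 a) (Φ '' Metric.closedBall 0 a) =
      capVolume n a * ENNReal.ofReal (c ^ n) := by
  rw [paramVolume_apply hΦ.measurable
    ((isCompact_closedBall _ _).image hΦ).isClosed.measurableSet,
    inter_eq_right.2 (subset_preimage_image _ _), ← lintegral_conformal a hc]
  exact lintegral_congr fun x => by rw [gramDensity_eq_of_conformal hc (h x)]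

end ParamVolume

/-! ### Regions with a polar chart -/

theorem convex_radii₀ (κ : ℝ) : Convex ℝ (radii₀ κ) :=
  OrdConnected.convex ⟨fun _ hr _ hs _ ht =>
    mem_radii₀_of_le hs ((nonneg_of_mem_radii₀ hr).trans ht.1) ht.2⟩

theorem interior_radii₀_subset (κ : ℝ) : interior (radii₀ κ) ⊆ radii κ := by
  intro r hr
  have hpos : r ∈ interior (Ici (0 : ℝ)) := interior_mono (fun _ => nonneg_of_mem_radii₀) hr
  rw [interior_Ici] at hpos
  exact mem_radii_of_mem_radii₀ (interior_subset hr) hpos.ne'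

/-- Geodesic polar coordinates `map (r, x)`, `0 ≤ r < T_κ`, `x ∈ D`, about the tip of the region
`X`, with unit radial velocity `vel`. Since `r` is not differentiable at the tip, it is given
implicitly, by `g = h r` with `g` a smooth function on the ambient space. The field `grad` says that
the gradient of `r` has Lorentzian norm at least one. -/
structure PolarChart {W P : Type*} [NormedAddCommGroup W] [NormedSpace ℝ W] [TopologicalSpace P]
    (B : W → W → ℝ) (T : W → W) (X : Set W) (κ : ℝ) (D : Set P) where
  tip : W
  map : ℝ × P → W
  vel : ℝ × P → W
  g : W → ℝ
  h : ℝ → ℝ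
  h' : ℝ → ℝ
  smul_right : ∀ (q v : W) (c : ℝ), B q (c • v) = c * B q v
  smul_left : ∀ (q v : W) (c : ℝ), B (c • q) v = c * B q v
  compact : IsCompact D
  nonempty : D.Nonempty
  continuous : Continuous map
  image_eq : map '' (radii₀ κ ×ˢ D) = X
  map_zero : ∀ x, map (0, x) = tip
  injOn : ∀ r ∈ radii κ, InjOn (fun x => map (r, x)) D
  contDiff : ContDiff ℝ 1 g
  g_map : ∀ r ∈ radii₀ κ, ∀ x ∈ D, g (map (r, x)) = h r
  hasDerivAt_h : ∀ r, HasDerivAt h (h' r) r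
  continuous_h' : Continuous h'
  h'_pos : ∀ r ∈ radii κ, 0 < h' r
  grad : ∀ {γ : ℝ → W} {s r : ℝ} {v : W} {x : P}, r ∈ radii κ → x ∈ D → γ s = map (r, x) →
    IsFutureVelocity B T X γ s v →
    0 < fderiv ℝ g (γ s) v ∧ h' r * Real.sqrt (-B v v) ≤ fderiv ℝ g (γ s) v
  contDiff_radial : ∀ x, ContDiff ℝ 1 fun r => map (r, x)
  hasDerivAt_radial : ∀ r x, HasDerivAt (fun r => map (r, x)) (vel (r, x)) r
  unit : ∀ r x, B (vel (r, x)) (vel (r, x)) = -1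
  future : ∀ r ∈ radii₀ κ, ∀ x, B (T (map (r, x))) (vel (r, x)) < 0

namespace PolarChart

variable {W P : Type*} [NormedAddCommGroup W] [NormedSpace ℝ W] [TopologicalSpace P]
  {B : W → W → ℝ} {T : W → W} {X : Set W} {κ : ℝ} {D : Set P} (C : PolarChart B T X κ D)
  {q : W} {r r' ρ : ℝ} {x : P} {J : Set ℝ}

theorem map_mem (hr : r ∈ radii₀ κ) (hx : x ∈ D) : C.map (r, x) ∈ X :=
  C.image_eq.subset (mem_image_of_mem C.map (mk_mem_prod hr hx))

theorem exists_map_eq (hq : q ∈ X) : ∃ r ∈ radii₀ κ, ∃ x ∈ D, C.map (r, x) = q := by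
  obtain ⟨⟨r, x⟩, ⟨hr, hx⟩, hqx⟩ := C.image_eq.ge hq
  exact ⟨r, hr, x, hx, hqx⟩

theorem tip_mem : C.tip ∈ X := by
  obtain ⟨x, hx⟩ := C.nonempty
  exact C.map_zero x ▸ C.map_mem (zero_mem_radii₀ κ) hx

theorem strictMonoOn_h : StrictMonoOn C.h (radii₀ κ) := by
  refine strictMonoOn_of_deriv_pos (convex_radii₀ κ)
    (fun r _ => (C.hasDerivAt_h r).continuousAt.continuousWithinAt) fun r hr => ?_
  rw [(C.hasDerivAt_h r).deriv]
  exact C.h'_pos r (interior_radii₀_subset κ hr)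

/-- The inverse of `h` on `[0, T_κ)`. -/
def hInv : ℝ → ℝ := Function.invFunOn C.h (radii₀ κ)

theorem hInv_h (hr : r ∈ radii₀ κ) : C.hInv (C.h r) = r :=
  C.strictMonoOn_h.injOn.leftInvOn_invFunOn hr

theorem hasDerivAt_hInv (hr : r ∈ radii κ) : HasDerivAt C.hInv (C.h' r)⁻¹ (C.h r) := by
  have hstrict : HasStrictDerivAt C.h (C.h' r) r :=
    hasStrictDerivAt_of_hasDerivAt_of_continuousAt (Eventually.of_forall C.hasDerivAt_h)
      C.continuous_h'.continuousAt
  refine (hstrict.to_local_left_inverse (C.h'_pos r hr).ne' ?_).hasDerivAt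
  filter_upwards [(isOpen_radii κ).mem_nhds hr] with s hs using
    C.hInv_h (radii_subset_radii₀ κ hs)

/-- The radial coordinate. -/
def radius (q : W) : ℝ := C.hInv (C.g q)

theorem radius_map (hr : r ∈ radii₀ κ) (hx : x ∈ D) : C.radius (C.map (r, x)) = r := by
  rw [radius, C.g_map r hr x hx, C.hInv_h hr]

theorem radius_eq_iff (hq : q ∈ X) (hρ : ρ ∈ radii₀ κ) :
    C.radius q = ρ ↔ ∃ x ∈ D, q = C.map (ρ, x) := by
  constructor
  · rintro rfl
    obtain ⟨r, hr, x, hx, rfl⟩ := C.exists_map_eq hq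
    exact ⟨x, hx, by rw [C.radius_map hr hx]⟩
  · rintro ⟨x, hx, rfl⟩
    exact C.radius_map hρ hx

theorem radius_eq_iff_g_eq (hq : q ∈ X) (hρ : ρ ∈ radii₀ κ) :
    C.radius q = ρ ↔ C.g q = C.h ρ := by
  obtain ⟨r, hr, x, hx, rfl⟩ := C.exists_map_eq hq
  rw [C.radius_map hr hx, C.g_map r hr x hx, C.strictMonoOn_h.injOn.eq_iff hr hρ]

theorem radius_eq_zero_iff (hq : q ∈ X) : C.radius q = 0 ↔ q = C.tip := by
  simp only [C.radius_eq_iff hq (zero_mem_radii₀ κ), C.map_zero, exists_and_right]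
  exact and_iff_right C.nonempty

theorem exists_radii_map_eq (hq : q ∈ X) (hne : q ≠ C.tip) :
    ∃ r ∈ radii κ, ∃ x ∈ D, C.map (r, x) = q := by
  obtain ⟨r, hr, x, hx, rfl⟩ := C.exists_map_eq hq
  refine ⟨r, mem_radii_of_mem_radii₀ hr ?_, x, hx, rfl⟩
  rintro rfl
  exact hne (C.map_zero x)

theorem inter_radius_preimage (hJ : J ⊆ radii₀ κ) :
    X ∩ C.radius ⁻¹' J = C.map '' (J ×ˢ D) := by
  ext q
  constructor
  · rintro ⟨hq, hqJ⟩
    obtain ⟨x, hx, hqx⟩ := (C.radius_eq_iff hq (hJ hqJ)).1 rfl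
    exact ⟨(C.radius q, x), ⟨hqJ, hx⟩, hqx.symm⟩
  · rintro ⟨⟨r, x⟩, ⟨hr, hx⟩, rfl⟩
    refine ⟨C.map_mem (hJ hr) hx, ?_⟩
    rwa [mem_preimage, C.radius_map (hJ hr) hx]

theorem coe_image_level (hρ : ρ ∈ radii₀ κ) :
    (Subtype.val '' {q : X | C.radius q = ρ} : Set W) = (fun x => C.map (ρ, x)) '' D := by
  have hlevel : {q : X | C.radius q = ρ} = Subtype.val ⁻¹' (C.radius ⁻¹' {ρ}) := rfl
  rw [hlevel, Subtype.image_preimage_coe,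
    C.inter_radius_preimage (singleton_subset_iff.2 hρ), singleton_prod, image_image]

theorem injOn_map : InjOn C.map (radii κ ×ˢ D) := by
  rintro ⟨r, x⟩ ⟨hr : r ∈ radii κ, hx : x ∈ D⟩ ⟨r', x'⟩ ⟨hr' : r' ∈ radii κ, hx' : x' ∈ D⟩ heq
  have hrr' : r = r' := by
    rw [← C.radius_map (radii_subset_radii₀ κ hr) hx, heq,
      C.radius_map (radii_subset_radii₀ κ hr') hx']
  subst hrr'
  exact Prod.ext rfl (C.injOn r hr hx hx' heq)

section Measurable

variable [MeasurableSpace W] [BorelSpace W] [PolishSpace P] [MeasurableSpace P] [BorelSpace P]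

theorem measurableSet_map_image (hJ : J ⊆ radii κ) (hJm : MeasurableSet J) :
    MeasurableSet (C.map '' (J ×ˢ D)) :=
  (hJm.prod C.compact.measurableSet).image_of_continuousOn_injOn C.continuous.continuousOn
    (C.injOn_map.mono (prod_mono_left hJ))

include C in
theorem measurableSet_region : MeasurableSet X := by
  have htip : (fun x => C.map (0, x)) '' D = {C.tip} := by
    simp only [C.map_zero, C.nonempty.image_const]
  have hunion : C.map '' (radii₀ κ ×ˢ D) = {C.tip} ∪ C.map '' (radii κ ×ˢ D) := by
    rw [radii₀, insert_eq, union_prod, image_union, singleton_prod, image_image, htip]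
  rw [← C.image_eq, hunion]
  exact (measurableSet_singleton _).union
    (C.measurableSet_map_image Subset.rfl (isOpen_radii κ).measurableSet)

end Measurable

theorem isSteepTime : IsSteepTime B T X C.tip C.g C.hInv fun y => (C.h' (C.hInv y))⁻¹ where
  form_zero q := by simpa only [zero_smul, zero_mul] using C.smul_right q 0 0
  contDiff := C.contDiff
  strictMono := by
    rintro _ ⟨q, hq, rfl⟩ _ ⟨q', hq', rfl⟩ hlt
    obtain ⟨r, hr, x, hx, rfl⟩ := C.exists_map_eq hq
    obtain ⟨r', hr', x', hx', rfl⟩ := C.exists_map_eq hq'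
    rw [C.g_map r hr x hx, C.g_map r' hr' x' hx'] at hlt ⊢
    rwa [C.hInv_h hr, C.hInv_h hr', ← C.strictMonoOn_h.lt_iff_lt hr hr']
  hasDerivAt q hq hne := by
    obtain ⟨r, hr, x, hx, rfl⟩ := C.exists_radii_map_eq hq hne
    rw [C.g_map r (radii_subset_radii₀ κ hr) x hx, C.hInv_h (radii_subset_radii₀ κ hr)]
    exact C.hasDerivAt_hInv hr
  lt_of_ne q hq hne := by
    obtain ⟨r, hr, x, hx, rfl⟩ := C.exists_radii_map_eq hq hne
    have hr₀ := radii_subset_radii₀ κ hr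
    rw [← C.map_zero x, C.g_map r hr₀ x hx, C.g_map 0 (zero_mem_radii₀ κ) x hx]
    exact C.strictMonoOn_h (zero_mem_radii₀ κ) hr₀ hr.1
  grad {γ s v} hv hne := by
    obtain ⟨r, hr, x, hx, hγ⟩ := C.exists_radii_map_eq hv.mem_nhds.self_of_nhds hne
    have hgrad := C.grad hr hx hγ.symm hv
    have hr₀ := radii_subset_radii₀ κ hr
    rw [← hγ, C.g_map r hr₀ x hx, C.hInv_h hr₀, hγ, ← div_eq_inv_mul,
      le_div_iff₀' (C.h'_pos r hr)]
    exact hgrad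

/-- The radial curve with affinely changing radius, from radius `r` to radius `r'`. -/
def radialCurve (r r' : ℝ) (x : P) (s : ℝ) : W := C.map (r + s * (r' - r), x)

theorem hasDerivAt_radialCurve (r r' : ℝ) (x : P) (s : ℝ) :
    HasDerivAt (C.radialCurve r r' x) ((r' - r) • C.vel (r + s * (r' - r), x)) s :=
  (C.hasDerivAt_radial _ x).scomp s ((hasDerivAt_mul_const (r' - r)).const_add r)

theorem form_deriv_radialCurve (r r' : ℝ) (x : P) (s : ℝ) :
    B (deriv (C.radialCurve r r' x) s) (deriv (C.radialCurve r r' x) s) = -(r' - r) ^ 2 := by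
  rw [(C.hasDerivAt_radialCurve r r' x s).deriv, C.smul_right, C.smul_left, C.unit]
  ring

theorem isTimelikeCurve_radialCurve (hr : r ∈ radii₀ κ) (hr' : r' ∈ radii₀ κ) (hlt : r < r')
    (hx : x ∈ D) : IsTimelikeCurve B T X (C.radialCurve r r' x) := by
  have hpos : 0 < r' - r := sub_pos.2 hlt
  have hmem : ∀ s ∈ Icc (0 : ℝ) 1, r + s * (r' - r) ∈ radii₀ κ := fun s hs =>
    (convex_radii₀ κ).add_smul_sub_mem hr hr' hs
  refine ⟨?_, fun s hs => C.map_mem (hmem s hs) hx, ?_⟩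
  · have hsmooth : ContDiff ℝ 1 (C.radialCurve r r' x) :=
      (C.contDiff_radial x).comp (by fun_prop : ContDiff ℝ 1 fun s : ℝ => r + s * (r' - r))
    exact hsmooth.contDiffOn.exists_lipschitzOnWith one_ne_zero (convex_Icc 0 1) isCompact_Icc
  · filter_upwards [ae_restrict_mem measurableSet_Icc] with s hs
    rw [C.form_deriv_radialCurve, (C.hasDerivAt_radialCurve r r' x s).deriv, C.smul_right]
    exact ⟨neg_neg_of_pos (pow_pos hpos 2),
      mul_neg_of_pos_of_neg hpos (C.future _ (hmem s hs) x)⟩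

theorem properTime_radialCurve (hlt : r < r') (x : P) :
    properTime B (C.radialCurve r r' x) = ENNReal.ofReal (r' - r) := by
  simp only [properTime, C.form_deriv_radialCurve, neg_neg, Real.sqrt_sq (sub_nonneg.2 hlt.le),
    setLIntegral_const, Real.volume_Icc, sub_zero, ENNReal.ofReal_one, mul_one]

open Classical in
/-- The chart as a map into `X`, with the tip as value where `map` leaves `X`. -/
def lift (r : ℝ) (x : P) : X :=
  if hmem : C.map (r, x) ∈ X then ⟨C.map (r, x), hmem⟩ else ⟨C.tip, C.tip_mem⟩

theorem coe_lift (hr : r ∈ radii₀ κ) (hx : x ∈ D) : (C.lift r x : W) = C.map (r, x) := by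
  rw [lift, dif_pos (C.map_mem hr hx)]

section Model

variable [MeasurableSpace W] {μ : Measure W}

theorem radius_lt_of_le {q q' : X} (hle : (regionSpace B T μ X).le q q') (hne : q ≠ q') :
    C.radius q < C.radius q' := by
  obtain ⟨γ, hγ, hq, hq'⟩ := hle.resolve_left hne
  have hlt := C.isSteepTime.lt_of_causal hγ
  rwa [hq, hq'] at hlt

theorem τ_le (q q' : X) :
    (regionSpace B T μ X).τ q q' ≤ ENNReal.ofReal (C.radius q' - C.radius q) := by
  refine iSup₂_le ?_
  rintro γ ⟨hγ, hq, hq'⟩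
  have hle := C.isSteepTime.properTime_le hγ
  rwa [hq, hq'] at hle

theorem le_τ (hr : r ∈ radii₀ κ) (hr' : r' ∈ radii₀ κ) (hlt : r < r') (hx : x ∈ D) :
    ENNReal.ofReal (r' - r) ≤ (regionSpace B T μ X).τ (C.lift r x) (C.lift r' x) := by
  rw [← C.properTime_radialCurve hlt x]
  refine le_iSup₂_of_le _ ⟨C.isTimelikeCurve_radialCurve hr hr' hlt hx, ?_, ?_⟩ le_rfl
  · rw [C.coe_lift hr hx, radialCurve, zero_mul, add_zero]
  · rw [C.coe_lift hr' hx, radialCurve, one_mul, add_sub_cancel]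

variable [BorelSpace W] [PolishSpace P] [MeasurableSpace P] [BorelSpace P]

include C in
theorem vol_preimage (A : Set W) :
    (regionSpace B T μ X).vol (Subtype.val ⁻¹' A) = μ (X ∩ A) := by
  change μ.comap Subtype.val _ = _
  rw [(MeasurableEmbedding.subtype_coe C.measurableSet_region).comap_apply,
    Subtype.image_preimage_coe]

theorem polarModel {n : ℕ} {ω : ENNReal}
    (hvol : ∀ J ⊆ radii κ, MeasurableSet J →
      μ (C.map '' (J ×ˢ D)) = ω * ∫⁻ r in J, ENNReal.ofReal (sn κ r ^ n))
    (htip : μ {C.tip} = 0) (hω : ω ≠ 0) (hω' : ω ≠ ⊤) :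
    PolarModel (regionSpace B T μ X) n κ D ω (fun q => C.radius q) C.lift where
  compact := C.compact
  nonempty := C.nonempty
  surj q := by
    obtain ⟨r, hr, x, hx, hqx⟩ := C.exists_map_eq q.2
    exact ⟨r, hr, x, hx, Subtype.ext ((C.coe_lift hr hx).trans hqx)⟩
  rad_E r hr x hx := by rw [C.coe_lift hr hx, C.radius_map hr hx]
  tip x hx y hy := Subtype.ext <| by
    rw [C.coe_lift (zero_mem_radii₀ κ) hx, C.coe_lift (zero_mem_radii₀ κ) hy, C.map_zero,
      C.map_zero]
  cont := by
    rw [IsInducing.subtypeVal.continuousOn_iff]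
    exact C.continuous.continuousOn.congr fun z hz => C.coe_lift hz.1 hz.2
  rad_lt _ _ := C.radius_lt_of_le
  τ_le := C.τ_le
  le_τ _ hr _ hr' hlt _ hx := C.le_τ hr hr' hlt hx
  vol J hJ hJm := by
    rw [← hvol J hJ hJm, ← C.inter_radius_preimage (hJ.trans (radii_subset_radii₀ κ))]
    exact C.vol_preimage (C.radius ⁻¹' J)
  vol_tip := by
    have hlevel : {q : X | C.radius q = 0} = Subtype.val ⁻¹' {C.tip} := by
      ext q
      exact C.radius_eq_zero_iff q.2
    rw [hlevel, C.vol_preimage]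
    exact measure_mono_null inter_subset_right htip
  ω_ne_zero := hω
  ω_ne_top := hω'

end Model

end PolarChart

/-! ### Reverse Cauchy–Schwarz -/

section ReverseCauchySchwarz

variable {E : Type*} [NormedAddCommGroup E] [InnerProductSpace ℝ E] {x ξ : E} {t θ : ℝ}

theorem reverse_cauchy_schwarz (h : ‖x‖ ^ 2 ≤ t ^ 2) :
    (t ^ 2 - ‖x‖ ^ 2) * (θ ^ 2 - ‖ξ‖ ^ 2) ≤ (t * θ - inner ℝ x ξ) ^ 2 := by
  rcases eq_or_ne x 0 with rfl | hx
  · rw [norm_zero, inner_zero_left]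
    nlinarith [sq_nonneg (t * ‖ξ‖)]
  · have hpos : 0 < ‖x‖ ^ 2 := by positivity
    have hinner : inner ℝ x ξ ^ 2 ≤ ‖x‖ ^ 2 * ‖ξ‖ ^ 2 := by
      rw [← mul_pow]
      exact sq_le_sq.2 ((abs_real_inner_le_norm x ξ).trans (le_abs_self _))
    refine le_of_mul_le_mul_left ?_ hpos
    nlinarith [sq_nonneg (‖x‖ ^ 2 * θ - t * inner ℝ x ξ),
      mul_nonneg (sub_nonneg.2 h) (sub_nonneg.2 hinner)]

theorem inner_lt_mul_of_timelike_of_causal (h : ‖x‖ ^ 2 < t ^ 2) (ht : 0 < t)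
    (hξ : ‖ξ‖ ^ 2 ≤ θ ^ 2) (hθ : 0 < θ) : inner ℝ x ξ < t * θ := calc
  inner ℝ x ξ ≤ ‖x‖ * ‖ξ‖ := real_inner_le_norm x ξ
  _ ≤ ‖x‖ * θ := mul_le_mul_of_nonneg_left (le_of_sq_le_sq hξ hθ.le) (norm_nonneg x)
  _ < t * θ := mul_lt_mul_of_pos_right (lt_of_pow_lt_pow_left₀ 2 ht.le h) hθ

theorem mul_sqrt_le_of_sq_mul_le_sq {c A Y : ℝ} (hc : 0 ≤ c) (hY : 0 ≤ Y)
    (h : c ^ 2 * A ≤ Y ^ 2) : c * Real.sqrt A ≤ Y := by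
  rw [← Real.sqrt_sq hc, ← Real.sqrt_mul (sq_nonneg c)]
  exact Real.sqrt_le_iff.2 ⟨hY, h⟩

end ReverseCauchySchwarz

/-! ### Minkowski space -/

section Minkowski

variable {n : ℕ} {a r ρ : ℝ}

theorem minkForm_smul_right (q v : Mink n) (c : ℝ) : minkForm n q (c • v) = c * minkForm n q v := by
  simp only [minkForm, Prod.smul_fst, Prod.smul_snd, real_inner_smul_right, smul_eq_mul]
  ring

theorem minkForm_smul_left (q v : Mink n) (c : ℝ) : minkForm n (c • q) v = c * minkForm n q v := by
  simp only [minkForm, Prod.smul_fst, Prod.smul_snd, real_inner_smul_left, smul_eq_mul]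
  ring

theorem minkForm_self (v : Mink n) : minkForm n v v = ‖v.1‖ ^ 2 - v.2 ^ 2 := by
  rw [minkForm, real_inner_self_eq_norm_sq, sq v.2]

theorem minkForm_hyp_self (x : Euc n) : minkForm n (hyp n x) (hyp n x) = -1 := by
  rw [minkForm_self, ← neg_sub, hyp_form_self]

theorem minkForm_smul_hyp (r : ℝ) (x : Euc n) :
    (r • hyp n x).2 ^ 2 - ‖(r • hyp n x).1‖ ^ 2 = r ^ 2 := by
  rw [← neg_sub, ← minkForm_self, minkForm_smul_right, minkForm_smul_left, minkForm_hyp_self]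
  ring

theorem smul_hyp (hr : 0 ≤ r) (x : Euc n) :
    r • hyp n x = (r • x, Real.sqrt (r ^ 2 + ‖r • x‖ ^ 2)) := by
  have hsq : r ^ 2 + ‖r • x‖ ^ 2 = r ^ 2 * (1 + ‖x‖ ^ 2) := by
    rw [norm_smul, mul_pow, Real.norm_eq_abs, sq_abs]
    ring
  rw [hsq, Real.sqrt_mul (sq_nonneg r), Real.sqrt_sq hr]
  rfl

theorem hasFDerivAt_minkNormSq (q : Mink n) :
    HasFDerivAt (fun q : Mink n => q.2 ^ 2 - ‖q.1‖ ^ 2)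
      ((2 * q.2) • ContinuousLinearMap.snd ℝ (Euc n) ℝ -
        (2 • innerSL ℝ q.1).comp (ContinuousLinearMap.fst ℝ (Euc n) ℝ)) q := by
  have hfst := HasFDerivAt.comp (g := fun x : Euc n => ‖x‖ ^ 2) q
    (hasStrictFDerivAt_norm_sq q.1).hasFDerivAt hasFDerivAt_fst
  have hsnd := (hasFDerivAt_snd (𝕜 := ℝ) (p := q)).pow 2
  refine (hsnd.sub hfst).congr_fderiv ?_
  rw [Nat.add_one_sub_one, pow_one, nsmul_eq_mul, Nat.cast_ofNat]

theorem fderiv_minkNormSq_apply (q v : Mink n) :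
    fderiv ℝ (fun q : Mink n => q.2 ^ 2 - ‖q.1‖ ^ 2) q v =
      2 * (q.2 * v.2 - inner ℝ q.1 v.1) := by
  rw [(hasFDerivAt_minkNormSq q).fderiv]
  change 2 * q.2 * v.2 - 2 • inner ℝ q.1 v.1 = _
  rw [nsmul_eq_mul, Nat.cast_ofNat]
  ring

theorem mem_radii_zero : r ∈ radii 0 ↔ 0 < r :=
  and_iff_left fun h => absurd h (lt_irrefl 0)

theorem mem_minkCone_iff (ha : 0 < a) {q : Mink n} :
    q ∈ minkCone n a ↔ 0 ≤ q.2 ∧ ‖q.1‖ ^ 2 ≤ a ^ 2 * (q.2 ^ 2 - ‖q.1‖ ^ 2) := by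
  have hsq : (‖q.1‖ * Real.sqrt (1 + a ^ 2)) ^ 2 = ‖q.1‖ ^ 2 * (1 + a ^ 2) := by
    rw [mul_pow, Real.sq_sqrt (by positivity)]
  rw [minkCone, mem_ofPred_eq, div_le_iff₀ ha]
  constructor
  · intro h
    have hsq_le := pow_le_pow_left₀ (by positivity) h 2
    exact ⟨nonneg_of_mul_nonneg_left (le_trans (by positivity) h) ha, by nlinarith⟩
  · rintro ⟨ht, h⟩
    exact le_of_sq_le_sq (by nlinarith) (by positivity)

theorem smul_hyp_mem_minkCone (ha : 0 < a) (hr : 0 ≤ r) {x : Euc n} (hx : ‖x‖ ≤ a) :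
    r • hyp n x ∈ minkCone n a := by
  rw [mem_minkCone_iff ha, minkForm_smul_hyp]
  refine ⟨mul_nonneg hr (hyp_snd_pos x).le, ?_⟩
  rw [smul_hyp hr, norm_smul, mul_pow, mul_comm, Real.norm_eq_abs, sq_abs]
  gcongr

theorem exists_smul_hyp_of_mem_minkCone (ha : 0 < a) {q : Mink n} (hq : q ∈ minkCone n a) :
    ∃ r ∈ radii₀ 0, ∃ x ∈ Metric.closedBall (0 : Euc n) a, r • hyp n x = q := by
  obtain ⟨ht, hnorm⟩ := (mem_minkCone_iff ha).1 hq
  have hform : 0 ≤ q.2 ^ 2 - ‖q.1‖ ^ 2 :=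
    nonneg_of_mul_nonneg_right ((sq_nonneg _).trans hnorm) (by positivity)
  obtain ⟨r, hr, hrq⟩ : ∃ r : ℝ, 0 ≤ r ∧ r ^ 2 = q.2 ^ 2 - ‖q.1‖ ^ 2 :=
    ⟨_, Real.sqrt_nonneg _, Real.sq_sqrt hform⟩
  rw [← hrq, ← mul_pow] at hnorm
  have hle : ‖q.1‖ ≤ a * r := le_of_sq_le_sq hnorm (by positivity)
  rcases hr.eq_or_lt with rfl | hr
  · have hfst : q.1 = 0 := norm_le_zero_iff.1 (hle.trans_eq (mul_zero a))
    have hsnd : q.2 = 0 := by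
      rw [hfst, norm_zero] at hrq
      exact pow_eq_zero_iff two_ne_zero |>.1 (by linarith)
    exact ⟨0, zero_mem_radii₀ 0, 0, Metric.mem_closedBall_self ha.le,
      (zero_smul ℝ _).trans (Prod.ext hfst.symm hsnd.symm)⟩
  · refine ⟨r, radii_subset_radii₀ 0 (mem_radii_zero.2 hr), r⁻¹ • q.1, ?_, ?_⟩
    · rw [mem_closedBall_zero_iff, norm_smul, norm_inv, Real.norm_of_nonneg hr.le,
        inv_mul_le_iff₀ hr, mul_comm]
      exact hle
    · rw [smul_hyp hr.le, smul_inv_smul₀ hr.ne', hrq, sub_add_cancel, Real.sqrt_sq ht]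

theorem minkNormSq_grad {q v : Mink n} {x : Euc n} (hr : 0 < r) (hq : q = r • hyp n x)
    (hcausal : minkForm n v v ≤ 0) (hfuture : minkForm n (minkTime n q) v < 0) :
    0 < 2 * (q.2 * v.2 - inner ℝ q.1 v.1) ∧
      2 * r * Real.sqrt (-minkForm n v v) ≤ 2 * (q.2 * v.2 - inner ℝ q.1 v.1) := by
  have hform : q.2 ^ 2 - ‖q.1‖ ^ 2 = r ^ 2 := hq ▸ minkForm_smul_hyp r x
  have hlt : ‖q.1‖ ^ 2 < q.2 ^ 2 := sub_pos.1 (hform ▸ pow_pos hr 2)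
  have ht : 0 < q.2 := hq ▸ mul_pos hr (hyp_snd_pos x)
  have hθ : 0 < v.2 := by
    simpa only [minkForm, minkTime, inner_zero_left, zero_sub, one_mul, neg_neg_iff_pos]
      using hfuture
  rw [minkForm_self] at hcausal ⊢
  have hpos := sub_pos.2 (inner_lt_mul_of_timelike_of_causal hlt ht (sub_nonpos.1 hcausal) hθ)
  refine ⟨by positivity, ?_⟩
  rw [mul_assoc]
  refine mul_le_mul_of_nonneg_left (mul_sqrt_le_of_sq_mul_le_sq hr.le hpos.le ?_) zero_le_two
  rw [neg_sub, ← hform]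
  exact reverse_cauchy_schwarz hlt.le

/-- Hyperbolic polar coordinates on the solid cone. -/
def minkChart (n : ℕ) (ha : 0 < a) :
    PolarChart (minkForm n) (minkTime n) (minkCone n a) 0 (Metric.closedBall (0 : Euc n) a) where
  tip := 0
  map z := z.1 • hyp n z.2
  vel z := hyp n z.2
  g q := q.2 ^ 2 - ‖q.1‖ ^ 2
  h r := r ^ 2
  h' r := 2 * r
  smul_right := minkForm_smul_right
  smul_left := minkForm_smul_left
  compact := isCompact_closedBall _ _
  nonempty := ⟨0, Metric.mem_closedBall_self ha.le⟩
  continuous := continuous_fst.smul (continuous_hyp.comp continuous_snd)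
  image_eq := by
    refine Subset.antisymm ?_ fun q hq => ?_
    · rintro _ ⟨⟨r, x⟩, ⟨hr, hx⟩, rfl⟩
      exact smul_hyp_mem_minkCone ha (nonneg_of_mem_radii₀ hr) (mem_closedBall_zero_iff.1 hx)
    · obtain ⟨r, hr, x, hx, hrx⟩ := exists_smul_hyp_of_mem_minkCone ha hq
      exact ⟨(r, x), ⟨hr, hx⟩, hrx⟩
  map_zero x := zero_smul ℝ (hyp n x)
  injOn r hr _ _ _ _ h := smul_right_injective (Euc n) hr.1.ne' (congrArg Prod.fst h)
  contDiff := by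
    have hnorm : ContDiff ℝ 1 fun q : Mink n => ‖q.1‖ ^ 2 := contDiff_fst.norm_sq ℝ
    fun_prop
  g_map r _ x _ := minkForm_smul_hyp r x
  hasDerivAt_h r := by simpa only [Nat.cast_ofNat, Nat.add_one_sub_one, pow_one]
    using hasDerivAt_pow 2 r
  continuous_h' := by fun_prop
  h'_pos r hr := mul_pos two_pos hr.1
  grad {γ s r v x} hr _ hγ hv := by
    rw [fderiv_minkNormSq_apply]
    exact minkNormSq_grad hr.1 hγ hv.causal hv.future
  contDiff_radial x := contDiff_id.smul (contDiff_const (c := hyp n x))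
  hasDerivAt_radial r x := by simpa only [id_eq, one_smul] using
    (hasDerivAt_id r).smul_const (hyp n x)
  unit _ x := minkForm_hyp_self x
  future _ _ x := by
    simpa only [minkForm, minkTime, inner_zero_left, zero_sub, one_mul, neg_neg_iff_pos]
      using hyp_snd_pos x

theorem slice_image_smul_hyp {J : Set ℝ} (hJ : J ⊆ Ioi 0) (y : Euc n) :
    Prod.mk y ⁻¹' ((fun z : ℝ × Euc n => z.1 • hyp n z.2) '' (J ×ˢ Metric.closedBall 0 a)) =
      (fun r => Real.sqrt (r ^ 2 + ‖y‖ ^ 2)) '' (J ∩ {r | ‖y‖ ≤ a * r}) := by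
  have hscale : ∀ {r : ℝ}, 0 < r → ∀ x : Euc n,
      x ∈ Metric.closedBall (0 : Euc n) a ↔ ‖r • x‖ ≤ a * r := fun hr x => by
    rw [mem_closedBall_zero_iff, norm_smul, Real.norm_of_nonneg hr.le, mul_comm a,
      mul_le_mul_iff_right₀ hr]
  ext t
  constructor
  · rintro ⟨⟨r, x⟩, ⟨hr, hx⟩, hrx⟩
    have hr₀ : 0 < r := hJ hr
    obtain ⟨rfl, rfl⟩ := Prod.mk.inj ((smul_hyp hr₀.le x).symm.trans hrx)
    exact ⟨r, ⟨hr, (hscale hr₀ x).1 hx⟩, rfl⟩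
  · rintro ⟨r, ⟨hr, hy⟩, rfl⟩
    have hr₀ : 0 < r := hJ hr
    have hry : r • r⁻¹ • y = y := smul_inv_smul₀ hr₀.ne' y
    refine ⟨(r, r⁻¹ • y), ⟨hr, (hscale hr₀ _).2 (by rwa [hry])⟩, ?_⟩
    exact (smul_hyp hr₀.le _).trans (by rw [hry])

theorem volume_image_sqrt_add {J : Set ℝ} (hJ : J ⊆ Ioi 0) (hJm : MeasurableSet J) (c : ℝ) :
    volume ((fun r => Real.sqrt (r ^ 2 + c ^ 2)) '' J) =
      ∫⁻ r in J, ENNReal.ofReal (r / Real.sqrt (r ^ 2 + c ^ 2)) := by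
  have hderiv : ∀ r ∈ J, HasDerivWithinAt (fun r => Real.sqrt (r ^ 2 + c ^ 2))
      (r / Real.sqrt (r ^ 2 + c ^ 2)) J r := fun r hr => by
    have hr₀ : 0 < r := hJ hr
    have hsq : HasDerivAt (fun r : ℝ => r ^ 2 + c ^ 2) (2 * r) r := by
      simpa only [Nat.cast_ofNat, Nat.add_one_sub_one, pow_one] using
        (hasDerivAt_pow 2 r).add_const (c ^ 2)
    refine ((hsq.sqrt (by positivity)).congr_deriv ?_).hasDerivWithinAt
    field_simp
  have hinj : InjOn (fun r => Real.sqrt (r ^ 2 + c ^ 2)) J := fun r hr s hs h =>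
    (pow_left_inj₀ (hJ hr).le (hJ hs).le two_ne_zero).1
      (add_right_cancel ((Real.sqrt_inj (by positivity) (by positivity)).1 h))
  rw [← setLIntegral_one]
  refine (lintegral_image_eq_lintegral_abs_deriv_mul hJm hderiv hinj 1).trans
    (setLIntegral_congr_fun hJm fun r hr => ?_)
  have hr₀ : 0 < r := hJ hr
  rw [abs_of_nonneg (by positivity), Pi.one_apply, mul_one]

theorem div_sqrt_eq_scaled_capDensity (hr : 0 < r) (y : Euc n) :
    r / Real.sqrt (r ^ 2 + ‖y‖ ^ 2) = (Real.sqrt (1 + ‖r⁻¹ • y‖ ^ 2))⁻¹ := by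
  have hsnd : r * Real.sqrt (1 + ‖r⁻¹ • y‖ ^ 2) = Real.sqrt (r ^ 2 + ‖y‖ ^ 2) := by
    have hsmul := congrArg Prod.snd (smul_hyp hr.le (r⁻¹ • y))
    rwa [smul_inv_smul₀ hr.ne'] at hsmul
  rw [← hsnd, div_mul_cancel_left₀ hr.ne']

theorem lintegral_scaled_capDensity (a : ℝ) (hr : 0 < r) :
    ∫⁻ y in {y : Euc n | ‖y‖ ≤ a * r}, ENNReal.ofReal (r / Real.sqrt (r ^ 2 + ‖y‖ ^ 2)) =
      capVolume n a * ENNReal.ofReal (r ^ n) := by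
  have hball : (fun y : Euc n => r⁻¹ • y) ⁻¹' Metric.closedBall 0 a = {y | ‖y‖ ≤ a * r} := by
    ext y
    rw [mem_preimage, mem_closedBall_zero_iff, norm_smul, norm_inv, Real.norm_of_nonneg hr.le,
      inv_mul_le_iff₀ hr, mul_comm]
    rfl
  simp only [div_sqrt_eq_scaled_capDensity hr]
  rw [← hball, ← setLIntegral_map Metric.isClosed_closedBall.measurableSet measurable_capDensity
    (measurable_const_smul r⁻¹), Measure.map_addHaar_smul _ (inv_ne_zero hr.ne'),
    Measure.restrict_smul, lintegral_smul_measure, finrank_euclideanSpace_fin, inv_pow, inv_inv,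
    abs_of_pos (by positivity), smul_eq_mul, mul_comm, capVolume]

theorem volume_image_smul_hyp (ha : 0 < a) {J : Set ℝ} (hJ : J ⊆ radii 0)
    (hJm : MeasurableSet J) :
    volume ((fun z : ℝ × Euc n => z.1 • hyp n z.2) '' (J ×ˢ Metric.closedBall 0 a)) =
      capVolume n a * ∫⁻ r in J, ENNReal.ofReal (r ^ n) := by
  have hJ₀ : J ⊆ Ioi 0 := fun r hr => (hJ hr).1
  have hcone : MeasurableSet {z : Euc n × ℝ | ‖z.1‖ ≤ a * z.2} :=
    (isClosed_le (by fun_prop) (by fun_prop)).measurableSet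
  have himage : MeasurableSet
      ((fun z : ℝ × Euc n => z.1 • hyp n z.2) '' (J ×ˢ Metric.closedBall 0 a)) :=
    (minkChart n ha).measurableSet_map_image hJ hJm
  let F (y : Euc n) (r : ℝ) : ENNReal := {z : Euc n × ℝ | ‖z.1‖ ≤ a * z.2}.indicator
    (fun z => ENNReal.ofReal (z.2 / Real.sqrt (z.2 ^ 2 + ‖z.1‖ ^ 2))) (y, r)
  have hF : Measurable (Function.uncurry F) := Measurable.indicator (by fun_prop) hcone
  have hvertical : ∀ y : Euc n, volume (Prod.mk y ⁻¹'
      ((fun z : ℝ × Euc n => z.1 • hyp n z.2) '' (J ×ˢ Metric.closedBall 0 a))) =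
      ∫⁻ r in J, F y r := fun y => by
    have hmeas : MeasurableSet {r : ℝ | ‖y‖ ≤ a * r} := measurable_prodMk_left hcone
    rw [slice_image_smul_hyp hJ₀, volume_image_sqrt_add (inter_subset_left.trans hJ₀)
      (hJm.inter hmeas), inter_comm, ← Measure.restrict_restrict hmeas, ← lintegral_indicator hmeas]
    rfl
  have hhorizontal : ∀ r ∈ J, ∫⁻ y, F y r = capVolume n a * ENNReal.ofReal (r ^ n) := fun r hr => by
    have hmeas : MeasurableSet {y : Euc n | ‖y‖ ≤ a * r} := measurable_prodMk_right hcone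
    rw [← lintegral_scaled_capDensity a (hJ₀ hr), ← lintegral_indicator hmeas]
    rfl
  rw [Measure.volume_eq_prod, Measure.prod_apply himage, lintegral_congr hvertical,
    lintegral_lintegral_swap hF.aemeasurable, setLIntegral_congr_fun hJm hhorizontal,
    lintegral_const_mul _ (by fun_prop)]

theorem minkTip_eq (ha : 0 < a) :
    minkTip n a = {q : minkCone n a | (minkChart n ha).radius q = 0} := by
  ext q
  exact ((minkChart n ha).radius_eq_zero_iff q.2).symm

theorem minkSlice_eq (ha : 0 < a) (hρ : 0 < ρ) :
    minkSlice n a ρ = {q : minkCone n a | (minkChart n ha).radius q = ρ} := by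
  ext q
  exact ((minkChart n ha).radius_eq_iff_g_eq q.2
    (radii_subset_radii₀ 0 (mem_radii_zero.2 hρ))).symm

theorem minkSliceArea_eq (ha : 0 < a) (hρ : 0 < ρ) :
    minkSliceArea n a ρ = capVolume n a * ENNReal.ofReal (sn 0 ρ ^ n) := by
  rw [minkSliceArea, minkSlice_eq ha hρ, (minkChart n ha).coe_image_level
    (radii_subset_radii₀ 0 (mem_radii_zero.2 hρ)), sn_zero_left]
  refine paramVolume_image_of_conformal a hρ.le (continuous_hyp.const_smul ρ) fun x u v => ?_
  rw [fderiv_fun_const_smul (hasFDerivAt_hyp x).differentiableAt]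
  simp only [smul_apply, minkForm_smul_left, minkForm_smul_right]
  ring

theorem attainsEquality_mink {N : ℕ} (ha : 0 < a) (hρ : 0 < ρ) :
    AttainsEquality (minkSpace (N - 1) a) 0 N (minkTip (N - 1) a) (minkSlice (N - 1) a ρ) ρ
      (minkSliceArea (N - 1) a ρ) := by
  rw [minkTip_eq ha, minkSlice_eq ha hρ, minkSliceArea_eq ha hρ]
  refine ((minkChart (N - 1) ha).polarModel (fun J hJ hJm => ?_) ?_ (capVolume_ne_zero ha)
    (capVolume_ne_top a)).attainsEquality (zero_div _).symm rfl (mem_radii_zero.2 hρ) rfl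
  · simp only [sn_zero_left]
    exact volume_image_smul_hyp ha hJ hJm
  · rw [Measure.volume_eq_prod]
    exact measure_singleton _

theorem DKN_zero {N : ℕ} (hN : N ≠ 0) (hρ : ρ ≠ 0) : DKN 0 N ρ = ρ / N := by
  obtain ⟨m, rfl⟩ := Nat.exists_eq_succ_of_ne_zero hN
  simp only [DKN, zero_div, sn_zero_left, integral_pow, Nat.succ_eq_add_one, Nat.add_sub_cancel]
  push_cast
  field_simp
  ring

theorem AttainsEquality.content_mul_dist {X : Type*} [TopologicalSpace X] [MeasurableSpace X]
    {L : Space X} {N : ℕ} {V S : Set X} {A : ENNReal} (h : AttainsEquality L 0 N V S ρ A)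
    (hN : N ≠ 0) (hρ : ρ ≠ 0) :
    L.minkowskiContent S * (L.dist V S).toENNReal = N * L.vol (L.cone V S) := by
  have hN₀ : (0 : ℝ) < N := Nat.cast_pos.2 hN.bot_lt
  rw [← h.equality, h.dist_eq, EReal.toReal_coe, DKN_zero hN hρ, ENNReal.ofReal_div_of_pos hN₀,
    ENNReal.ofReal_natCast, EReal.toENNReal_of_ne_top (EReal.coe_ne_top ρ), EReal.toReal_coe,
    mul_left_comm, ENNReal.mul_div_cancel (Nat.cast_ne_zero.2 hN) (ENNReal.natCast_ne_top N)]

end Minkowski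

/-! ### Quadrics in polar coordinates -/

section Quadric

variable {n : ℕ} {κ σ a r : ℝ}

/-- The ambient form `x · x' - t t' + σ w w'`, which is that of de Sitter space for `σ = 1` and that
of anti-de Sitter space for `σ = -1`. -/
def ambForm (n : ℕ) (σ : ℝ) (u v : Amb n) : ℝ :=
  minkForm n (u.1, u.2.1) (v.1, v.2.1) + σ * (u.2.2 * v.2.2)

theorem ambForm_one : ambForm n 1 = dSForm n := by
  funext u v
  rw [ambForm, minkForm, dSForm, one_mul]

theorem ambForm_neg_one : ambForm n (-1) = adSForm n := by
  funext u v
  rw [ambForm, minkForm, adSForm, neg_one_mul, ← sub_eq_add_neg]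

theorem ambForm_prodAssoc (σ : ℝ) (u v : Mink n) (w ω : ℝ) :
    ambForm n σ (ContinuousLinearEquiv.prodAssoc ℝ (Euc n) ℝ ℝ (u, w))
      (ContinuousLinearEquiv.prodAssoc ℝ (Euc n) ℝ ℝ (v, ω)) = minkForm n u v + σ * (w * ω) :=
  rfl

theorem ambForm_smul_right (σ : ℝ) (q v : Amb n) (c : ℝ) :
    ambForm n σ q (c • v) = c * ambForm n σ q v := by
  simp only [ambForm, minkForm, Prod.smul_fst, Prod.smul_snd, real_inner_smul_right, smul_eq_mul]
  ring

theorem ambForm_smul_left (σ : ℝ) (q v : Amb n) (c : ℝ) :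
    ambForm n σ (c • q) v = c * ambForm n σ q v := by
  simp only [ambForm, minkForm, Prod.smul_fst, Prod.smul_snd, real_inner_smul_left, smul_eq_mul]
  ring

theorem ambForm_self (σ : ℝ) (v : Amb n) :
    ambForm n σ v v = ‖v.1‖ ^ 2 - v.2.1 ^ 2 + σ * v.2.2 ^ 2 := by
  rw [ambForm, minkForm_self, sq v.2.2]

theorem ambForm_eq_zero_of_hasDerivAt {c s : ℝ} {γ : ℝ → Amb n} {v : Amb n}
    (hconst : ∀ᶠ s' in 𝓝 s, ambForm n σ (γ s') (γ s') = c) (hγ : HasDerivAt γ v s) :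
    ambForm n σ (γ s) v = 0 := by
  have hderiv : HasDerivAt (fun s => ambForm n σ (γ s) (γ s)) (2 * ambForm n σ (γ s) v) s := by
    simp only [ambForm_self]
    have hx : HasDerivAt (fun s => (γ s).1) v.1 s := hγ.fst
    have ht : HasDerivAt (fun s => (γ s).2.1) v.2.1 s := hγ.snd.fst
    have hw : HasDerivAt (fun s => (γ s).2.2) v.2.2 s := hγ.snd.snd
    refine ((hx.norm_sq.fun_sub (ht.fun_pow 2)).fun_add
      ((hw.fun_pow 2).const_mul σ)).congr_deriv ?_
    simp only [ambForm, minkForm, Nat.cast_ofNat, Nat.add_one_sub_one, pow_one]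
    ring
  have hzero := hderiv.unique ((hasDerivAt_const s c).congr_of_eventuallyEq hconst)
  exact (mul_eq_zero.1 hzero).resolve_left two_ne_zero

theorem contDiff_sn (κ : ℝ) : ContDiff ℝ 1 (sn κ) :=
  contDiff_one_iff_deriv.2 ⟨fun r => (hasDerivAt_sn κ r).differentiableAt, by
    rw [funext fun r => (hasDerivAt_sn κ r).deriv]
    exact continuous_iff_continuousAt.2 fun r => (hasDerivAt_cs κ r).continuousAt⟩

theorem contDiff_cs (κ : ℝ) : ContDiff ℝ 1 (cs κ) :=
  contDiff_one_iff_deriv.2 ⟨fun r => (hasDerivAt_cs κ r).differentiableAt, by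
    rw [funext fun r => (hasDerivAt_cs κ r).deriv]
    exact (continuous_sn κ).const_mul (-κ)⟩

theorem contDiff_hyp : ContDiff ℝ 1 (hyp n) :=
  contDiff_id.prodMk ((contDiff_const.add (contDiff_norm_sq ℝ)).sqrt fun _ => by positivity)

/-- Geodesic polar coordinates about the base point `(0, 0, 1/√|κ|)`. -/
def polarPt (n : ℕ) (κ : ℝ) (z : ℝ × Euc n) : Amb n := expPt n κ z.1 (hyp n z.2)

theorem polarPt_zero (κ : ℝ) (x : Euc n) : polarPt n κ (0, x) = (0, 0, 1 / Real.sqrt |κ|) := by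
  rw [polarPt, expPt, sn_zero, cs_zero, zero_smul, zero_mul]

theorem polarPt_eq (κ : ℝ) (z : ℝ × Euc n) :
    polarPt n κ z = ContinuousLinearEquiv.prodAssoc ℝ (Euc n) ℝ ℝ
      (sn κ z.1 • hyp n z.2, cs κ z.1 / Real.sqrt |κ|) :=
  rfl

theorem contDiff_polarPt (κ : ℝ) : ContDiff ℝ 1 (polarPt n κ) :=
  (ContinuousLinearEquiv.prodAssoc ℝ (Euc n) ℝ ℝ).contDiff.comp
    ((((contDiff_sn κ).comp contDiff_fst).smul (contDiff_hyp.comp contDiff_snd)).prodMk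
      (((contDiff_cs κ).comp contDiff_fst).div_const _))

theorem hasFDerivAt_polarPt (κ r : ℝ) (x : Euc n) :
    HasFDerivAt (polarPt n κ) (fderiv ℝ (polarPt n κ) (r, x)) (r, x) :=
  ((contDiff_polarPt κ).differentiable one_ne_zero _).hasFDerivAt

theorem fderiv_polarPt_apply (κ r : ℝ) (x : Euc n) (z : ℝ × Euc n) :
    fderiv ℝ (polarPt n κ) (r, x) z = ContinuousLinearEquiv.prodAssoc ℝ (Euc n) ℝ ℝ
      (sn κ r • fderiv ℝ (hyp n) x z.2 + (cs κ r * z.1) • hyp n x,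
        -κ * sn κ r / Real.sqrt |κ| * z.1) := by
  have hsn : HasFDerivAt (fun z : ℝ × Euc n => sn κ z.1)
      (cs κ r • ContinuousLinearMap.fst ℝ ℝ (Euc n)) (r, x) :=
    (hasDerivAt_sn κ r).comp_hasFDerivAt_of_eq (r, x) hasFDerivAt_fst rfl
  have hcs : HasFDerivAt (fun z : ℝ × Euc n => cs κ z.1 / Real.sqrt |κ|)
      ((-κ * sn κ r / Real.sqrt |κ|) • ContinuousLinearMap.fst ℝ ℝ (Euc n)) (r, x) :=
    ((hasDerivAt_cs κ r).div_const (Real.sqrt |κ|)).comp_hasFDerivAt_of_eq (r, x)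
      hasFDerivAt_fst rfl
  have hhyp : HasFDerivAt (fun z : ℝ × Euc n => hyp n z.2)
      ((fderiv ℝ (hyp n) x).comp (ContinuousLinearMap.snd ℝ ℝ (Euc n))) (r, x) :=
    (hasFDerivAt_hyp x).differentiableAt.hasFDerivAt.comp (g := hyp n) (f := Prod.snd) (r, x)
      hasFDerivAt_snd
  have hpolar := (ContinuousLinearEquiv.prodAssoc ℝ (Euc n) ℝ ℝ).hasFDerivAt.comp (r, x)
    ((hsn.smul hhyp).prodMk hcs)
  exact congrArg (fun L => L z) hpolar.fderiv

/-- The unit radial vector field `∂_r`. -/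
def radialField (n : ℕ) (κ : ℝ) (z : ℝ × Euc n) : Amb n := fderiv ℝ (polarPt n κ) z (1, 0)

theorem radialField_eq (κ r : ℝ) (x : Euc n) :
    radialField n κ (r, x) = ContinuousLinearEquiv.prodAssoc ℝ (Euc n) ℝ ℝ
      (cs κ r • hyp n x, -κ * sn κ r / Real.sqrt |κ|) := by
  rw [radialField, fderiv_polarPt_apply, map_zero, smul_zero, zero_add, mul_one, mul_one]

theorem minkForm_smul_fderiv_hyp_add (x u v : Euc n) (s b c : ℝ) :
    minkForm n (s • fderiv ℝ (hyp n) x u + b • hyp n x)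
      (s • fderiv ℝ (hyp n) x v + c • hyp n x) =
    s ^ 2 * minkForm n (fderiv ℝ (hyp n) x u) (fderiv ℝ (hyp n) x v) - b * c := by
  have hu := minkForm_hyp_fderiv x u
  have hv := minkForm_hyp_fderiv x v
  have hx := minkForm_hyp_self x
  simp only [minkForm, Prod.fst_add, Prod.snd_add, Prod.smul_fst, Prod.smul_snd, inner_add_left,
    inner_add_right, real_inner_smul_left, real_inner_smul_right, smul_eq_mul] at hu hv hx ⊢
  rw [real_inner_comm] at hu
  linear_combination s * c * hu + s * b * hv + b * c * hx

theorem mul_div_sqrt_abs_sq (hσ : σ * |κ| = -κ) (hκ : κ ≠ 0) (y : ℝ) :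
    σ * (y / Real.sqrt |κ|) ^ 2 = -(y ^ 2 / κ) := by
  have habs : 0 < |κ| := abs_pos.2 hκ
  rw [div_pow, Real.sq_sqrt habs.le, eq_div_of_mul_eq habs.ne' hσ, div_mul_div_comm, ← sq, sq_abs]
  field_simp

theorem sq_eq_one_of_mul_abs (hσ : σ * |κ| = -κ) (hκ : κ ≠ 0) : σ ^ 2 = 1 := by
  have habs : κ ^ 2 ≠ 0 := pow_ne_zero 2 hκ
  refine mul_right_cancel₀ habs ?_
  rw [one_mul, ← sq_abs κ, ← mul_pow, hσ, neg_sq, sq_abs]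

theorem ambForm_polarPt (hσ : σ * |κ| = -κ) (hκ : κ ≠ 0) (z : ℝ × Euc n) :
    ambForm n σ (polarPt n κ z) (polarPt n κ z) = 1 / -κ := by
  have hform : minkForm n (sn κ z.1 • hyp n z.2) (sn κ z.1 • hyp n z.2) = -sn κ z.1 ^ 2 := by
    rw [minkForm_smul_left, minkForm_smul_right, minkForm_hyp_self]
    ring
  rw [polarPt_eq, ambForm_prodAssoc, hform, ← sq, mul_div_sqrt_abs_sq hσ hκ]
  field_simp
  linear_combination -cs_sq_add κ z.1

theorem ambForm_fderiv_polarPt (hσ : σ * |κ| = -κ) (hκ : κ ≠ 0) (r : ℝ) (x : Euc n)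
    (z z' : ℝ × Euc n) :
    ambForm n σ (fderiv ℝ (polarPt n κ) (r, x) z) (fderiv ℝ (polarPt n κ) (r, x) z') =
      sn κ r ^ 2 * minkForm n (fderiv ℝ (hyp n) x z.2) (fderiv ℝ (hyp n) x z'.2) -
        z.1 * z'.1 := by
  have hcoeff : σ * (-κ * sn κ r / Real.sqrt |κ|) ^ 2 = -κ * sn κ r ^ 2 := by
    rw [mul_div_sqrt_abs_sq hσ hκ]
    field_simp
  rw [fderiv_polarPt_apply, fderiv_polarPt_apply, ambForm_prodAssoc, minkForm_smul_fderiv_hyp_add]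
  linear_combination z.1 * z'.1 * hcoeff - z.1 * z'.1 * cs_sq_add κ r

theorem ambForm_radialField (hσ : σ * |κ| = -κ) (hκ : κ ≠ 0) (z : ℝ × Euc n) :
    ambForm n σ (radialField n κ z) (radialField n κ z) = -1 := by
  rw [radialField, ambForm_fderiv_polarPt hσ hκ, minkForm_fderiv_hyp]
  simp

theorem gramDensity_polarPt (hσ : σ * |κ| = -κ) (hκ : κ ≠ 0) (hs : 0 ≤ sn κ r) (x : Euc n) :
    gramDensity (ambForm n σ) (polarBasis n) (polarPt n κ) (r, x) =
      sn κ r ^ n * (Real.sqrt (1 + ‖x‖ ^ 2))⁻¹ := by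
  rw [← gramDensity_hyp, gramDensity, gramDensity]
  simp only [ambForm_fderiv_polarPt hσ hκ]
  set M := Matrix.of fun i j => minkForm n (fderiv ℝ (hyp n) x (eucBasis n i))
    (fderiv ℝ (hyp n) x (eucBasis n j))
  have hblocks : (Matrix.of fun i j => sn κ r ^ 2 * minkForm n
      (fderiv ℝ (hyp n) x (polarBasis n i).2) (fderiv ℝ (hyp n) x (polarBasis n j).2) -
      (polarBasis n i).1 * (polarBasis n j).1) =
      Matrix.fromBlocks (-1 : Matrix Unit Unit ℝ) 0 0 (sn κ r ^ 2 • M) := by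
    ext (i | i) (j | j) <;> simp [polarBasis, M, minkForm]
  have hdet : |(-1 : Matrix Unit Unit ℝ).det| = 1 := by
    rw [Matrix.det_unique, Matrix.neg_apply, Matrix.one_apply_eq, abs_neg, abs_one]
  rw [hblocks, Matrix.det_fromBlocks_zero₂₁, Matrix.det_smul, Fintype.card_fin, abs_mul, abs_mul,
    hdet, one_mul, abs_of_nonneg (by positivity), Real.sqrt_mul (by positivity), ← pow_mul,
    mul_comm 2 n, pow_mul, Real.sqrt_sq (by positivity)]

theorem quadricVolume_apply (hσ : σ * |κ| = -κ) (hκ : κ ≠ 0) {A : Set (Amb n)}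
    (hA : MeasurableSet A) {J : Set ℝ} (hJ : J ⊆ radii κ) (hJm : MeasurableSet J)
    (hAJ : polarPt n κ ⁻¹' A ∩ radii κ ×ˢ univ = J ×ˢ Metric.closedBall 0 a) :
    quadricVolume n (ambForm n σ) κ A = capVolume n a * ∫⁻ r in J, ENNReal.ofReal (sn κ r ^ n) := by
  have hdensity : ∀ z ∈ J ×ˢ Metric.closedBall (0 : Euc n) a,
      ENNReal.ofReal (gramDensity (ambForm n σ) (polarBasis n) (polarPt n κ) z) =
      ENNReal.ofReal (sn κ z.1 ^ n) * ENNReal.ofReal (Real.sqrt (1 + ‖z.2‖ ^ 2))⁻¹ := by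
    rintro ⟨r, x⟩ ⟨hr, -⟩
    have hs := (sn_pos (hJ hr)).le
    rw [gramDensity_polarPt hσ hκ hs, ENNReal.ofReal_mul (pow_nonneg hs n)]
  refine (paramVolume_apply (contDiff_polarPt κ).continuous.measurable hA).trans ?_
  rw [hAJ, setLIntegral_congr_fun (hJm.prod Metric.isClosed_closedBall.measurableSet) hdensity,
    Measure.volume_eq_prod, ← Measure.prod_restrict,
    lintegral_prod_mul (f := fun r => ENNReal.ofReal (sn κ r ^ n))
      ((continuous_sn κ).pow n).measurable.ennreal_ofReal.aemeasurable
      measurable_capDensity.aemeasurable, mul_comm, capVolume]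

theorem paramVolume_polarPt (hσ : σ * |κ| = -κ) (hκ : κ ≠ 0) (hs : 0 ≤ sn κ r) (a : ℝ) :
    paramVolume (ambForm n σ) (eucBasis n) (fun x => polarPt n κ (r, x)) (Metric.closedBall 0 a)
      ((fun x => polarPt n κ (r, x)) '' Metric.closedBall 0 a) =
    capVolume n a * ENNReal.ofReal (sn κ r ^ n) := by
  have hpartial : ∀ x u : Euc n, fderiv ℝ (fun x => polarPt n κ (r, x)) x u =
      fderiv ℝ (polarPt n κ) (r, x) (0, u) := fun x u =>
    congrArg (fun L => L u)
      ((hasFDerivAt_polarPt κ r x).comp x (hasFDerivAt_prodMk_right r x)).fderiv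
  refine paramVolume_image_of_conformal a hs
    ((contDiff_polarPt κ).continuous.comp (Continuous.prodMk_right r)) fun x u v => ?_
  rw [hpartial, hpartial, ambForm_fderiv_polarPt hσ hκ, mul_zero, sub_zero]

end Quadric

/-! ### Conical regions in quadrics -/

section QuadricCone

variable {n : ℕ} {κ σ a r ρ : ℝ} {T : Amb n → Amb n}

/-- The quadric of curvature `-κ`. -/
def quadric (n : ℕ) (σ κ : ℝ) : Set (Amb n) := {q | ambForm n σ q q = 1 / -κ}

/-- The geodesics issuing from the base point of the quadric are future directed for the time
orientation `T`, and `σ w`, an increasing function of the radius, increases along every future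
causal vector. The sign of `σ` is opposite to that of `κ`. -/
structure IsRadialOrientation (σ κ : ℝ) (T : Amb n → Amb n) : Prop where
  mul_abs : σ * |κ| = -κ
  ne_zero : κ ≠ 0
  radial_future : ∀ r x, ambForm n σ (T (polarPt n κ (r, x))) (radialField n κ (r, x)) < 0
  height_pos : ∀ r ∈ radii κ, ∀ (x : Euc n) (v : Amb n), ambForm n σ (polarPt n κ (r, x)) v = 0 →
    ambForm n σ v v ≤ 0 → ambForm n σ (T (polarPt n κ (r, x))) v < 0 → 0 < σ * v.2.2

theorem image_polarPt_eq_quadricCone (hσ : σ * |κ| = -κ) (hκ : κ ≠ 0) (a : ℝ) :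
    polarPt n κ '' (radii₀ κ ×ˢ Metric.closedBall 0 a) = quadricCone n (quadric n σ κ) κ a := by
  ext q
  simp only [quadricCone, hypCap_eq_image, exists_mem_image]
  constructor
  · rintro ⟨⟨r, x⟩, ⟨hr, hx⟩, rfl⟩
    exact ⟨ambForm_polarPt hσ hκ (r, x), r, hr, x, hx, rfl⟩
  · rintro ⟨-, r, hr, x, hx, rfl⟩
    exact ⟨(r, x), ⟨hr, hx⟩, rfl⟩

theorem form_polarPt_fst (κ r : ℝ) (x : Euc n) :
    (polarPt n κ (r, x)).2.1 ^ 2 - ‖(polarPt n κ (r, x)).1‖ ^ 2 = sn κ r ^ 2 :=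
  minkForm_smul_hyp (sn κ r) x

theorem mul_sqrt_le_height (hσ : σ * |κ| = -κ) (hκ : κ ≠ 0) (hs : 0 ≤ sn κ r) {x : Euc n}
    {v : Amb n} (htan : ambForm n σ (polarPt n κ (r, x)) v = 0) (hpos : 0 ≤ σ * v.2.2) :
    Real.sqrt |κ| * sn κ r * Real.sqrt (-ambForm n σ v v) ≤ σ * v.2.2 := by
  set q := polarPt n κ (r, x)
  have hnorm : q.2.1 ^ 2 - ‖q.1‖ ^ 2 = sn κ r ^ 2 := form_polarPt_fst κ r x
  have hcs : Real.sqrt |κ| * q.2.2 = cs κ r :=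
    mul_div_cancel₀ _ (Real.sqrt_pos.2 (abs_pos.2 hκ)).ne'
  have hinner : q.2.1 * v.2.1 - inner ℝ q.1 v.1 = q.2.2 * (σ * v.2.2) := by
    simp only [ambForm, minkForm] at htan
    linear_combination -htan
  have hcauchy : sn κ r ^ 2 * (v.2.1 ^ 2 - ‖v.1‖ ^ 2) ≤ (q.2.2 * (σ * v.2.2)) ^ 2 := by
    rw [← hnorm, ← hinner]
    exact reverse_cauchy_schwarz (sub_nonneg.1 (hnorm ▸ sq_nonneg _))
  refine mul_sqrt_le_of_sq_mul_le_sq (by positivity) hpos ?_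
  calc (Real.sqrt |κ| * sn κ r) ^ 2 * -ambForm n σ v v
      = Real.sqrt |κ| ^ 2 * (sn κ r ^ 2 * (v.2.1 ^ 2 - ‖v.1‖ ^ 2))
          - σ * Real.sqrt |κ| ^ 2 * sn κ r ^ 2 * v.2.2 ^ 2 := by
        rw [ambForm_self]
        ring
    _ ≤ Real.sqrt |κ| ^ 2 * (q.2.2 * (σ * v.2.2)) ^ 2
          - σ * Real.sqrt |κ| ^ 2 * sn κ r ^ 2 * v.2.2 ^ 2 := by gcongr
    _ = (σ * v.2.2) ^ 2 := by
        rw [← mul_pow, ← mul_assoc, hcs, Real.sq_sqrt (abs_nonneg κ), hσ]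
        linear_combination (σ * v.2.2) ^ 2 * cs_sq_add κ r
          - κ * sn κ r ^ 2 * v.2.2 ^ 2 * sq_eq_one_of_mul_abs hσ hκ

theorem mul_neg_eq_abs (hσ : σ * |κ| = -κ) (hκ : κ ≠ 0) : σ * -κ = |κ| := by
  rw [← hσ, ← mul_assoc, ← sq, sq_eq_one_of_mul_abs hσ hκ, one_mul]

theorem fderiv_height_apply (σ : ℝ) (q v : Amb n) :
    fderiv ℝ (fun q : Amb n => σ * q.2.2) q v = σ * v.2.2 := by
  have hsnd : HasFDerivAt (fun q : Amb n => q.2.2) ((ContinuousLinearMap.snd ℝ ℝ ℝ).comp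
      (ContinuousLinearMap.snd ℝ (Euc n) (ℝ × ℝ))) q :=
    ((ContinuousLinearMap.snd ℝ ℝ ℝ).comp
      (ContinuousLinearMap.snd ℝ (Euc n) (ℝ × ℝ))).hasFDerivAt
  rw [(hsnd.const_mul σ).fderiv]
  rfl

theorem IsFutureVelocity.ambForm_eq_zero {γ : ℝ → Amb n} {s : ℝ} {v : Amb n}
    (hv : IsFutureVelocity (ambForm n σ) T (quadricCone n (quadric n σ κ) κ a) γ s v) :
    ambForm n σ (γ s) v = 0 :=
  ambForm_eq_zero_of_hasDerivAt (hv.mem_nhds.mono fun _ hs => hs.1) hv.hasDerivAt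

namespace IsRadialOrientation

variable (H : IsRadialOrientation σ κ T)

/-- Geodesic polar coordinates on the conical region. -/
def chart (ha : 0 < a) : PolarChart (ambForm n σ) T (quadricCone n (quadric n σ κ) κ a) κ
    (Metric.closedBall (0 : Euc n) a) where
  tip := (0, 0, 1 / Real.sqrt |κ|)
  map := polarPt n κ
  vel := radialField n κ
  g q := σ * q.2.2
  h r := σ * (cs κ r / Real.sqrt |κ|)
  h' r := Real.sqrt |κ| * sn κ r
  smul_right := ambForm_smul_right σ
  smul_left := ambForm_smul_left σ
  compact := isCompact_closedBall _ _
  nonempty := ⟨0, Metric.mem_closedBall_self ha.le⟩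
  continuous := (contDiff_polarPt κ).continuous
  image_eq := image_polarPt_eq_quadricCone H.mul_abs H.ne_zero a
  map_zero := polarPt_zero κ
  injOn r hr _ _ _ _ h := smul_right_injective (Euc n) (sn_pos hr).ne' (congrArg Prod.fst h)
  contDiff := by fun_prop
  g_map _ _ _ _ := rfl
  hasDerivAt_h r := by
    refine (((hasDerivAt_cs κ r).div_const _).const_mul σ).congr_deriv ?_
    rw [← mul_div_assoc, ← mul_assoc, mul_neg_eq_abs H.mul_abs H.ne_zero, mul_div_right_comm,
      Real.div_sqrt]
  continuous_h' := (continuous_sn κ).const_mul _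
  h'_pos r hr := mul_pos (Real.sqrt_pos.2 (abs_pos.2 H.ne_zero)) (sn_pos hr)
  grad {γ s r v x} hr _ hγ hv := by
    have htan := hv.ambForm_eq_zero
    have hfuture := hv.future
    rw [hγ] at htan hfuture
    have hpos := H.height_pos r hr x v htan hv.causal hfuture
    rw [fderiv_height_apply]
    exact ⟨hpos, mul_sqrt_le_height H.mul_abs H.ne_zero (sn_pos hr).le htan hpos.le⟩
  contDiff_radial x := (contDiff_polarPt κ).comp (contDiff_prodMk_left x)
  hasDerivAt_radial r x := (hasFDerivAt_polarPt κ r x).comp_hasDerivAt (f := fun r => (r, x)) r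
    ((hasDerivAt_id' r).prodMk (hasDerivAt_const r x))
  unit r x := ambForm_radialField H.mul_abs H.ne_zero (r, x)
  future r _ x := H.radial_future r x

include H in
theorem injOn_polarPt : InjOn (polarPt n κ) (radii κ ×ˢ univ) := by
  rintro ⟨r, x⟩ ⟨hr : r ∈ radii κ, -⟩ ⟨r', x'⟩ ⟨hr' : r' ∈ radii κ, -⟩ h
  have hrr' : r = r' := (H.chart one_pos).strictMonoOn_h.injOn (radii_subset_radii₀ κ hr)
    (radii_subset_radii₀ κ hr') (congrArg (fun q : Amb n => σ * q.2.2) h)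
  subst hrr'
  exact Prod.ext rfl (smul_right_injective (Euc n) (sn_pos hr).ne' (congrArg Prod.fst h))

include H in
theorem quadricVolume_image {J : Set ℝ} (ha : 0 < a) (hJ : J ⊆ radii κ) (hJm : MeasurableSet J) :
    quadricVolume n (ambForm n σ) κ (polarPt n κ '' (J ×ˢ Metric.closedBall 0 a)) =
      capVolume n a * ∫⁻ r in J, ENNReal.ofReal (sn κ r ^ n) :=
  quadricVolume_apply H.mul_abs H.ne_zero ((H.chart ha).measurableSet_map_image hJ hJm) hJ hJm
    (H.injOn_polarPt.preimage_image_inter (prod_mono hJ (subset_univ _)))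

include H in
theorem quadricVolume_tip :
    quadricVolume n (ambForm n σ) κ {(0, 0, 1 / Real.sqrt |κ|)} = 0 := by
  rw [quadricVolume_apply (a := 0) H.mul_abs H.ne_zero (measurableSet_singleton _)
    (empty_subset _) MeasurableSet.empty]
  · rw [setLIntegral_empty, mul_zero]
  · rw [empty_prod, eq_empty_iff_forall_notMem]
    rintro ⟨r, x⟩ ⟨h, hr : r ∈ radii κ, -⟩
    exact (mul_pos (sn_pos hr) (hyp_snd_pos x)).ne' (congrArg (fun q : Amb n => q.2.1) h)

theorem quadricTip_eq (ha : 0 < a) :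
    quadricTip n (quadric n σ κ) κ a =
      {q : quadricCone n (quadric n σ κ) κ a | (H.chart ha).radius q = 0} := by
  ext q
  exact ((H.chart ha).radius_eq_zero_iff q.2).symm

theorem quadricSlice_eq (ha : 0 < a) (hρ : ρ ∈ radii κ) :
    quadricSlice n (quadric n σ κ) κ a ρ =
      {q : quadricCone n (quadric n σ κ) κ a | (H.chart ha).radius q = ρ} := by
  ext q
  rw [quadricSlice, hypCap_eq_image]
  simp only [exists_mem_image]
  exact ((H.chart ha).radius_eq_iff q.2 (radii_subset_radii₀ κ hρ)).symm

include H in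
theorem quadricSliceArea_eq (ha : 0 < a) (hρ : ρ ∈ radii κ) :
    quadricSliceArea n (ambForm n σ) (quadric n σ κ) κ a ρ =
      capVolume n a * ENNReal.ofReal (sn κ ρ ^ n) := by
  rw [quadricSliceArea, H.quadricSlice_eq ha hρ,
    (H.chart ha).coe_image_level (radii_subset_radii₀ κ hρ)]
  exact paramVolume_polarPt H.mul_abs H.ne_zero (sn_pos hρ).le a

end IsRadialOrientation

theorem IsRadialOrientation.attainsEquality {K : ℝ} {N : ℕ} {T : Amb (N - 1) → Amb (N - 1)}
    (H : IsRadialOrientation σ κ T) (ha : 0 < a) (hK : κ = K / ((N : ℝ) - 1)) (hρ : ρ ∈ radii κ) :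
    AttainsEquality (regionSpace (ambForm (N - 1) σ) T (quadricVolume (N - 1) (ambForm (N - 1) σ) κ)
        (quadricCone (N - 1) (quadric (N - 1) σ κ) κ a)) K N
      (quadricTip (N - 1) (quadric (N - 1) σ κ) κ a)
      (quadricSlice (N - 1) (quadric (N - 1) σ κ) κ a ρ) ρ
      (quadricSliceArea (N - 1) (ambForm (N - 1) σ) (quadric (N - 1) σ κ) κ a ρ) := by
  rw [H.quadricTip_eq ha, H.quadricSlice_eq ha hρ, H.quadricSliceArea_eq ha hρ]
  exact ((H.chart ha).polarModel (fun J => H.quadricVolume_image ha) H.quadricVolume_tip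
    (capVolume_ne_zero ha) (capVolume_ne_top a)).attainsEquality hK rfl hρ rfl

/-! ### Anti-de Sitter space -/

theorem ambForm_adSTime (q v : Amb n) :
    ambForm n (-1) (adSTime n q) v = q.2.1 * v.2.2 - q.2.2 * v.2.1 := by
  simp only [ambForm, minkForm, adSTime, inner_zero_left]
  ring

theorem height_neg_of_adSTime {q v : Amb n} (ht : 0 < q.2.1) (hq : ‖q.1‖ ^ 2 < q.2.1 ^ 2)
    (htan : ambForm n (-1) q v = 0) (hcausal : ambForm n (-1) v v ≤ 0)
    (hfuture : ambForm n (-1) (adSTime n q) v < 0) : v.2.2 < 0 := by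
  obtain ⟨x, t, w⟩ := q
  obtain ⟨ξ, θ, ω⟩ := v
  rw [ambForm_adSTime] at hfuture
  rw [ambForm_self] at hcausal
  simp only [ambForm, minkForm] at *
  by_contra! hω
  have hcauchy : inner ℝ x ξ ^ 2 ≤ ‖x‖ ^ 2 * ‖ξ‖ ^ 2 := by
    rw [← mul_pow]
    exact sq_le_sq.2 ((abs_real_inner_le_norm x ξ).trans (le_abs_self _))
  have hinner : inner ℝ x ξ = t * θ + w * ω := by linarith
  have hξ : ‖x‖ ^ 2 * ‖ξ‖ ^ 2 ≤ ‖x‖ ^ 2 * (θ ^ 2 + ω ^ 2) :=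
    mul_le_mul_of_nonneg_left (by linarith) (sq_nonneg _)
  have hcross : 0 ≤ t * ω * (w * θ - t * ω) := by
    have := sub_nonneg.2 (sub_neg.1 hfuture).le
    positivity
  have hle : (t ^ 2 - ‖x‖ ^ 2) * (θ ^ 2 + ω ^ 2) ≤ 0 := by
    rw [hinner] at hcauchy
    nlinarith [sq_nonneg (t * ω), sq_nonneg (w * ω)]
  have hzero : θ ^ 2 + ω ^ 2 ≤ 0 := nonpos_of_mul_nonpos_right hle (sub_pos.2 hq)
  have hθ₀ : θ = 0 := by nlinarith
  have hω₀ : ω = 0 := by nlinarith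
  rw [hθ₀, hω₀, mul_zero, mul_zero, sub_zero] at hfuture
  exact hfuture.false

theorem isRadialOrientation_adS (hκ : 0 < κ) : IsRadialOrientation (-1) κ (adSTime n) where
  mul_abs := by rw [abs_of_pos hκ, neg_one_mul]
  ne_zero := hκ.ne'
  radial_future r x := by
    have heq : ambForm n (-1) (adSTime n (polarPt n κ (r, x))) (radialField n κ (r, x)) =
        -((cs κ r ^ 2 + κ * sn κ r ^ 2) * (hyp n x).2 / Real.sqrt |κ|) := by
      rw [ambForm_adSTime, radialField_eq]
      change sn κ r * (hyp n x).2 * (-κ * sn κ r / Real.sqrt |κ|) -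
        cs κ r / Real.sqrt |κ| * (cs κ r * (hyp n x).2) = _
      ring
    rw [heq, cs_sq_add, one_mul]
    exact neg_neg_of_pos (div_pos (hyp_snd_pos x) (Real.sqrt_pos.2 (abs_pos.2 hκ.ne')))
  height_pos r hr x v htan hcausal hfuture := by
    rw [neg_one_mul, neg_pos]
    refine height_neg_of_adSTime (mul_pos (sn_pos hr) (hyp_snd_pos x)) ?_ htan hcausal hfuture
    exact sub_pos.1 (form_polarPt_fst κ r x ▸ pow_pos (sn_pos hr) 2)

theorem attainsEquality_adS {K : ℝ} {N : ℕ} (hκ : 0 < κ) (ha : 0 < a)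
    (hK : κ = K / ((N : ℝ) - 1)) (hρ : ρ ∈ radii κ) :
    AttainsEquality (adSSpace (N - 1) κ a) K N
      (quadricTip (N - 1) (antiDeSitter (N - 1) (-κ)) κ a)
      (quadricSlice (N - 1) (antiDeSitter (N - 1) (-κ)) κ a ρ) ρ
      (quadricSliceArea (N - 1) (adSForm (N - 1)) (antiDeSitter (N - 1) (-κ)) κ a ρ) := by
  unfold adSSpace antiDeSitter
  rw [← ambForm_neg_one]
  exact (isRadialOrientation_adS hκ).attainsEquality ha hK hρ

/-! ### De Sitter space -/

theorem one_le_cs (hκ : κ < 0) (r : ℝ) : 1 ≤ cs κ r := by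
  rw [cs_of_neg hκ]
  exact Real.one_le_cosh _

theorem ambForm_dSTime (q v : Amb n) : ambForm n 1 (dSTime n q) v = -v.2.1 := by
  simp only [ambForm, minkForm, dSTime, inner_zero_left, one_mul, zero_mul, zero_sub, add_zero]

theorem height_pos_of_dSTime {q v : Amb n} (ht : 0 < q.2.1) (hw : 0 < q.2.2)
    (hq : ‖q.1‖ ^ 2 < q.2.1 ^ 2) (htan : ambForm n 1 q v = 0) (hcausal : ambForm n 1 v v ≤ 0)
    (hfuture : ambForm n 1 (dSTime n q) v < 0) : 0 < v.2.2 := by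
  rw [ambForm_dSTime, neg_lt_zero] at hfuture
  rw [ambForm_self, one_mul] at hcausal
  have hlt := inner_lt_mul_of_timelike_of_causal (ξ := v.1) hq ht
    (by linarith [sq_nonneg v.2.2]) hfuture
  simp only [ambForm, minkForm] at htan
  exact pos_of_mul_pos_right (by linarith) hw.le

theorem isRadialOrientation_dS (hκ : κ < 0) : IsRadialOrientation 1 κ (dSTime n) where
  mul_abs := by rw [abs_of_neg hκ, one_mul]
  ne_zero := hκ.ne
  radial_future r x := by
    rw [ambForm_dSTime, radialField_eq]
    exact neg_neg_of_pos (mul_pos (zero_lt_one.trans_le (one_le_cs hκ r)) (hyp_snd_pos x))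
  height_pos r hr x v htan hcausal hfuture := by
    have hw : 0 < cs κ r / Real.sqrt |κ| :=
      div_pos (zero_lt_one.trans_le (one_le_cs hκ r)) (Real.sqrt_pos.2 (abs_pos.2 hκ.ne))
    rw [one_mul]
    refine height_pos_of_dSTime (mul_pos (sn_pos hr) (hyp_snd_pos x)) hw ?_ htan hcausal hfuture
    exact sub_pos.1 (form_polarPt_fst κ r x ▸ pow_pos (sn_pos hr) 2)

theorem attainsEquality_dS {K : ℝ} {N : ℕ} (hκ : κ < 0) (ha : 0 < a)
    (hK : κ = K / ((N : ℝ) - 1)) (hρ : ρ ∈ radii κ) :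
    AttainsEquality (dSSpace (N - 1) κ a) K N
      (quadricTip (N - 1) (deSitter (N - 1) (-κ)) κ a)
      (quadricSlice (N - 1) (deSitter (N - 1) (-κ)) κ a ρ) ρ
      (quadricSliceArea (N - 1) (dSForm (N - 1)) (deSitter (N - 1) (-κ)) κ a ρ) := by
  unfold dSSpace deSitter
  rw [← ambForm_one]
  exact (isRadialOrientation_dS hκ).attainsEquality ha hK hρ

end QuadricCone

end LorentzIsop

end

open LorentzIsop in
theorem proposition5p6 (N : ℕ) (hN : 2 ≤ N) :
    -- K = 0: Minkowski space
    (∀ a ρ : ℝ, 0 < a → 0 < ρ →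
      AttainsEquality (minkSpace (N - 1) a) 0 N
        (minkTip (N - 1) a) (minkSlice (N - 1) a ρ) ρ (minkSliceArea (N - 1) a ρ) ∧
      (minkSpace (N - 1) a).minkowskiContent (minkSlice (N - 1) a ρ) *
          ((minkSpace (N - 1) a).dist (minkTip (N - 1) a) (minkSlice (N - 1) a ρ)).toENNReal =
        N * (minkSpace (N - 1) a).vol
          ((minkSpace (N - 1) a).cone (minkTip (N - 1) a) (minkSlice (N - 1) a ρ))) ∧
    -- K > 0: the model space with Ric = K on unit timelike vectors (sectional curvature -κ < 0)
    (∀ K κ a ρ : ℝ, 0 < K → κ = K / ((N : ℝ) - 1) → 0 < a → ρ ∈ radii κ →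
      AttainsEquality (adSSpace (N - 1) κ a) K N
        (quadricTip (N - 1) (antiDeSitter (N - 1) (-κ)) κ a)
        (quadricSlice (N - 1) (antiDeSitter (N - 1) (-κ)) κ a ρ) ρ
        (quadricSliceArea (N - 1) (adSForm (N - 1)) (antiDeSitter (N - 1) (-κ)) κ a ρ)) ∧
    -- K < 0: the model space with Ric = K on unit timelike vectors (sectional curvature -κ > 0)
    (∀ K κ a ρ : ℝ, K < 0 → κ = K / ((N : ℝ) - 1) → 0 < a → ρ ∈ radii κ →
      AttainsEquality (dSSpace (N - 1) κ a) K N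
        (quadricTip (N - 1) (deSitter (N - 1) (-κ)) κ a)
        (quadricSlice (N - 1) (deSitter (N - 1) (-κ)) κ a ρ) ρ
        (quadricSliceArea (N - 1) (dSForm (N - 1)) (deSitter (N - 1) (-κ)) κ a ρ)) := by
  have hN' : 0 < (N : ℝ) - 1 := by
    have : (2 : ℝ) ≤ N := by exact_mod_cast hN
    linarith
  refine ⟨fun a ρ ha hρ => ?_, fun K κ a ρ hK hκ ha hρ => ?_, fun K κ a ρ hK hκ ha hρ => ?_⟩
  · have h := attainsEquality_mink (N := N) ha hρ
    exact ⟨h, h.content_mul_dist (by omega) hρ.ne'⟩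
  · exact attainsEquality_adS (hκ ▸ div_pos hK hN') ha hκ hρ
  · exact attainsEquality_dS (hκ ▸ div_neg_of_neg_of_pos hK hN') ha hκ hρ
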